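/- Let $E$ be a complex Banach space and let $D$ be the generator of a strongly continuous one-parameter group $(e^{tD})_{t\in\mathbb R}$ of linear isometries of $E$. Let $\mathcal D^\infty=\bigcap_{k\in\mathbb N}\mathcal D(D^k)$ and, for $\sigma>0$, let $$\mathbf B_\sigma(D)=\{f\in\mathcal D^\infty:\ \|D^kf\|\le\sigma^k\|f\|\ \text{ for all } k\in\mathbb N\}.$$ A function $F$ on $\mathbb C$ with values in a complex Banach space is called entire of exponential type $\sigma$ if it is entire and for every $\varepsilon>0$ there is $C$ with $\|F(z)\|\le Ce^{(\sigma+\varepsilon)|z|}$ for all $z\in\mathbb C$; $B_\sigma^\infty(\mathbb R)$ is the set of bounded functions $\mathbb R\to\mathbb C$ that extend to an entire function of exponential type $\sigma$. Let $\operatorname{sinc}x=\frac{\sin\pi x}{\pi x}$ for $x\neq0$, $\operatorname{sinc}0=1$, and for $m\in\mathbb N=\{1,2,\dots\}$, $k\in\mathbb Z$, put $$A_{m,k}=(-1)^{k+1}\operatorname{sinc}^{(2m-1)}\left(\tfrac12-k\right),\qquad B_{m,k}=(-1)^{k+1}\operatorname{sinc}^{(2m)}(-k)\ (k\ne0),\qquad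 B_{m,0}=(-1)^{m+1}\frac{\pi^{2m}}{2m+1},$$ $$\mathcal B_D^{(2m-1)}(\sigma)f=\left(\frac\sigma\pi\right)^{2m-1}\sum_{k\in\mathbb Z}(-1)^{k+1}A_{m,k}\,e^{\frac\pi\sigma(k-\frac12)D}f,\qquad \mathcal B_D^{(2m)}(\sigma)f=\left(\frac\sigma\pi\right)^{2m}\sum_{k\in\mathbb Z}(-1)^{k+1}B_{m,k}\,e^{\frac{\pi k}\sigma D}f .$$ Let $f\in E$. (I) For every $0<\sigma<\infty$ the following conditions are equivalent: 1. $f\in\mathbf B_\sigma(D)$; 2. the function $t\mapsto e^{tD}f$ is bounded on $\mathbb R$ and extends to an entire $E$-valued function of exponential type $\sigma$; 3. for every $g^*\in E^*$ the function $t\mapsto\langle e^{tD}f,g^*\rangle$ belongs to $B_\sigma^\infty(\mathbb R)$; 4. $f\in\mathcal D^\infty$ and $D^rf=\mathcal B_D^{(r)}(\sigma)f$ for all $r\in\mathbb N$, where the series converge in the norm of $E$; 5. $f\in\mathcal D^\infty$, the limit $d_f=\lim_{k\to\infty}\|D^kf\|^{1/k}$ exists and is finite, $d_f=\inf\{\tau>0: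 f\in\mathbf B_\tau(D)\}$, and $d_f\le\sigma$. (II) The following conditions, in which no $\sigma$ is fixed, are equivalent: 1. $f\in\mathbf B_\sigma(D)$ for some $0<\sigma<\infty$; 2. $f\in\mathcal D^\infty$, the limit $d_f=\lim_{k\to\infty}\|D^kf\|^{1/k}$ exists and is finite, and $d_f=\inf\{\tau>0: f\in\mathbf B_\tau(D)\}$; 3. $f\in\mathcal D^\infty$ and the limit $d_f=\lim_{k\to\infty}\|D^kf\|^{1/k}$ exists and is finite. -/

import Mathlib

open Filter Topology

noncomputable section

namespace BernsteinVectors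

/-- `T` is a strongly continuous one-parameter group of (linear) isometries of `E`. -/
structure IsIsometryGroup {E : Type*} [NormedAddCommGroup E] [NormedSpace ℂ E]
    (T : ℝ → E →L[ℂ] E) : Prop where
  map_zero : T 0 = ContinuousLinearMap.id ℂ E
  map_add : ∀ s t : ℝ, T (s + t) = (T s).comp (T t)
  isometry : ∀ (t : ℝ) (x : E), ‖T t x‖ = ‖x‖
  strongly_continuous : ∀ x : E, Continuous fun t : ℝ => T t x

/-- The (in general unbounded) operator `D` is the infinitesimal generator of `T`: `x` lies in the
domain of `D` and `D x = y` exactly when `(T t x - x) / t → y` in norm as `t → 0`, `t ≠ 0`. -/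
def IsGenerator {E : Type*} [NormedAddCommGroup E] [NormedSpace ℂ E]
    (D : E →ₗ.[ℂ] E) (T : ℝ → E →L[ℂ] E) : Prop :=
  ∀ x y : E, (∃ h : x ∈ D.domain, D ⟨x, h⟩ = y) ↔
    Tendsto (fun t : ℝ => (t : ℂ)⁻¹ • (T t x - x)) (𝓝[≠] 0) (𝓝 y)

open Classical in
/-- `D` extended by `0` outside of its domain. -/
def applyOrZero {E : Type*} [NormedAddCommGroup E] [NormedSpace ℂ E]
    (D : E →ₗ.[ℂ] E) (x : E) : E :=
  if h : x ∈ D.domain then D ⟨x, h⟩ else 0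

/-- `D ^ k f`; it is only used for `f` in the domain of `D ^ k`. -/
def powApply {E : Type*} [NormedAddCommGroup E] [NormedSpace ℂ E]
    (D : E →ₗ.[ℂ] E) (k : ℕ) (f : E) : E :=
  (applyOrZero D)^[k] f

/-- The domain of `D ^ k`: all `f` such that `f, D f, …, D ^ (k - 1) f` lie in the domain
of `D`. -/
def powDomain {E : Type*} [NormedAddCommGroup E] [NormedSpace ℂ E]
    (D : E →ₗ.[ℂ] E) (k : ℕ) : Set E :=
  {f | ∀ j < k, powApply D j f ∈ D.domain}

/-- `𝒟^∞`, the intersection of the domains of all powers of `D`. -/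
def smoothDomain {E : Type*} [NormedAddCommGroup E] [NormedSpace ℂ E]
    (D : E →ₗ.[ℂ] E) : Set E :=
  ⋂ k : ℕ, powDomain D k

/-- The Bernstein subspace `𝐁_σ(D)`. -/
def bernsteinSet {E : Type*} [NormedAddCommGroup E] [NormedSpace ℂ E]
    (D : E →ₗ.[ℂ] E) (σ : ℝ) : Set E :=
  {f | f ∈ smoothDomain D ∧ ∀ k : ℕ, ‖powApply D k f‖ ≤ σ ^ k * ‖f‖}

/-- `F : ℂ → X` is an entire function of exponential type (at most) `σ`. -/
def IsEntireOfExpType {X : Type*} [NormedAddCommGroup X] [NormedSpace ℂ X]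
    (σ : ℝ) (F : ℂ → X) : Prop :=
  Differentiable ℂ F ∧
    ∀ ε > 0, ∃ C : ℝ, ∀ z : ℂ, ‖F z‖ ≤ C * Real.exp ((σ + ε) * ‖z‖)

/-- `u : ℝ → X` is bounded and extends to an entire function of exponential type `σ`.
For `X = ℂ` this is the classical Bernstein space `B_σ^∞(ℝ)`. -/
def MemBernstein {X : Type*} [NormedAddCommGroup X] [NormedSpace ℂ X]
    (σ : ℝ) (u : ℝ → X) : Prop :=
  (∃ F : ℂ → X, IsEntireOfExpType σ F ∧ ∀ t : ℝ, F t = u t) ∧ ∃ M : ℝ, ∀ t : ℝ, ‖u t‖ ≤ M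

/-- `sinc x = sin (π x) / (π x)`, `sinc 0 = 1`. -/
def nsinc (x : ℝ) : ℝ := Real.sinc (Real.pi * x)

/-- `A_{m,k} = (-1)^(k+1) sinc^(2m-1)(1/2 - k)`. -/
def coeffA (m : ℕ) (k : ℤ) : ℝ :=
  (-1 : ℝ) ^ (k + 1) * iteratedDeriv (2 * m - 1) nsinc (1 / 2 - (k : ℝ))

/-- `B_{m,k} = (-1)^(k+1) sinc^(2m)(-k)` for `k ≠ 0`, `B_{m,0} = (-1)^(m+1) π^(2m) / (2m+1)`. -/
def coeffB (m : ℕ) (k : ℤ) : ℝ :=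
  if k = 0 then (-1 : ℝ) ^ (m + 1) * (Real.pi ^ (2 * m) / (2 * (m : ℝ) + 1))
  else (-1 : ℝ) ^ (k + 1) * iteratedDeriv (2 * m) nsinc (-(k : ℝ))

/-- The `k`-th term of the series for `𝓑_D^{(2m-1)}(σ) f`. -/
def boasOddTerm {E : Type*} [NormedAddCommGroup E] [NormedSpace ℂ E]
    (T : ℝ → E →L[ℂ] E) (σ : ℝ) (m : ℕ) (f : E) (k : ℤ) : E :=
  (((-1 : ℝ) ^ (k + 1) * coeffA m k : ℝ) : ℂ) • T (Real.pi / σ * ((k : ℝ) - 1 / 2)) f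

/-- The `k`-th term of the series for `𝓑_D^{(2m)}(σ) f`. -/
def boasEvenTerm {E : Type*} [NormedAddCommGroup E] [NormedSpace ℂ E]
    (T : ℝ → E →L[ℂ] E) (σ : ℝ) (m : ℕ) (f : E) (k : ℤ) : E :=
  (((-1 : ℝ) ^ (k + 1) * coeffB m k : ℝ) : ℂ) • T (Real.pi * (k : ℝ) / σ) f

/-- The Boas operator `𝓑_D^{(2m-1)}(σ)`, `m ≥ 1`. -/
def boasOdd {E : Type*} [NormedAddCommGroup E] [NormedSpace ℂ E]
    (T : ℝ → E →L[ℂ] E) (σ : ℝ) (m : ℕ) (f : E) : E :=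
  (((σ / Real.pi) ^ (2 * m - 1) : ℝ) : ℂ) • ∑' k : ℤ, boasOddTerm T σ m f k

/-- The Boas operator `𝓑_D^{(2m)}(σ)`, `m ≥ 1`. -/
def boasEven {E : Type*} [NormedAddCommGroup E] [NormedSpace ℂ E]
    (T : ℝ → E →L[ℂ] E) (σ : ℝ) (m : ℕ) (f : E) : E :=
  (((σ / Real.pi) ^ (2 * m) : ℝ) : ℂ) • ∑' k : ℤ, boasEvenTerm T σ m f k

/-- The Boas-type formulas: `f ∈ 𝒟^∞` and `D^r f = 𝓑_D^{(r)}(σ) f` for all `r ≥ 1` (odd and even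
`r` separately), where the series converge in the norm of `E`. -/
def BoasFormulas {E : Type*} [NormedAddCommGroup E] [NormedSpace ℂ E]
    (D : E →ₗ.[ℂ] E) (T : ℝ → E →L[ℂ] E) (σ : ℝ) (f : E) : Prop :=
  f ∈ smoothDomain D ∧ ∀ m : ℕ, 1 ≤ m →
    (Summable (boasOddTerm T σ m f) ∧ powApply D (2 * m - 1) f = boasOdd T σ m f) ∧
    (Summable (boasEvenTerm T σ m f) ∧ powApply D (2 * m) f = boasEven T σ m f)

/-- `f ∈ 𝒟^∞` and `‖D^k f‖^{1/k}` converges to the real number `d`. -/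
def HasPowLimit {E : Type*} [NormedAddCommGroup E] [NormedSpace ℂ E]
    (D : E →ₗ.[ℂ] E) (f : E) (d : ℝ) : Prop :=
  f ∈ smoothDomain D ∧
    Tendsto (fun k : ℕ => ‖powApply D k f‖ ^ (1 / (k : ℝ))) atTop (𝓝 d)

/-- All `τ > 0` with `f ∈ 𝐁_τ(D)`. -/
def admissible {E : Type*} [NormedAddCommGroup E] [NormedSpace ℂ E]
    (D : E →ₗ.[ℂ] E) (f : E) : Set ℝ :=
  {τ | 0 < τ ∧ f ∈ bernsteinSet D τ}

end BernsteinVectors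

end

noncomputable section

open MeasureTheory

namespace BernsteinVectors

/-! The core is the sampling formula for derivatives of a bounded function `u` of type `π`: the
`r`-th derivative at `0` is the sum over `k` of `bandKernel r (a - k) * u (k - a)`, with `a = 0` for
even `r` and `a = 1 / 2` for odd `r` (`hasSum_iteratedDeriv_of_memBernstein`). It comes from
expanding the multiplier `(2πiξ) ^ r` in a Fourier series on `[-1/2, 1/2]`. For `r = 1` the absolute
weights sum to exactly `π`, so the rescaled sum is an operator `boasOperator T σ` of norm at most
`σ` that commutes with the group.

If all scalar orbits of `f` have type `σ`, then `boasOperator T σ f` is the weak derivative of the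
orbit at `0`; an integral equation makes it the strong one. Hence `D` acts on `f` as a commuting
bounded operator of norm at most `σ`, and iterating gives the Bernstein inequalities. Conversely,
these inequalities make the Taylor series of the orbit converge to an entire function of type `σ`,
and testing the sampling formula against functionals yields every Boas formula.

For the limit of roots, the upper bound is immediate. The lower one rests on `norm_powApply_add_le`:
a single small `‖D ^ n f‖` controls the combinations `D ^ k f + ρ⁻² D ^ (k + 2) f` for all `k + 2 <
n`. If `‖D ^ n f‖ ≤ ρ ^ n` infinitely often, then `‖D ^ k f‖` is `ρ ^ k` up to a factor linear in
`k`, so `f` is a Bernstein vector for each `τ > ρ`. Thus the lower limit of the roots cannot fall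
below the infimum of the admissible `τ`. -/

/-! ### Derivatives of sinc as band-limited Fourier integrals. -/

/-- The `r`-th derivative of the normalized sinc function, as a Fourier integral. -/
def bandKernel (r : ℕ) (x : ℝ) : ℂ :=
  ∫ ξ in (-(1 / 2) : ℝ)..(1 / 2), (2 * Real.pi * Complex.I * ξ) ^ r *
    Complex.exp (2 * Real.pi * Complex.I * (x * ξ))

theorem hasDerivAt_bandKernel (r : ℕ) (x : ℝ) :
    HasDerivAt (bandKernel r) (bandKernel (r + 1) x) x := by
  unfold bandKernel
  refine (intervalIntegral.hasDerivAt_integral_of_dominated_loc_of_deriv_le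
    (𝕜 := ℝ) (F := fun (x : ℝ) (ξ : ℝ) => (2 * Real.pi * Complex.I * (ξ : ℂ)) ^ r *
      Complex.exp (2 * Real.pi * Complex.I * ((x : ℂ) * ξ)))
    (bound := fun ξ => ‖(2 * Real.pi * Complex.I * (ξ : ℂ)) ^ (r + 1)‖)
    (F' := fun (x : ℝ) (ξ : ℝ) => (2 * Real.pi * Complex.I * (ξ : ℂ)) ^ (r + 1) *
      Complex.exp (2 * Real.pi * Complex.I * ((x : ℂ) * ξ))) Filter.univ_mem ?_ ?_ ?_ ?_ ?_ ?_).2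
  · exact Filter.Eventually.of_forall fun y =>
      Continuous.aestronglyMeasurable (by fun_prop)
  · exact Continuous.intervalIntegrable (by fun_prop) _ _
  · exact Continuous.aestronglyMeasurable (by fun_prop)
  · refine ae_of_all _ fun ξ _ y _ => ?_
    rw [norm_mul]
    have : ‖Complex.exp (2 * Real.pi * Complex.I * ((y : ℂ) * ξ))‖ = 1 := by
      have := Complex.norm_exp_ofReal_mul_I (2 * Real.pi * (y * ξ))
      rw [← this]; congr 2; push_cast; ring
    rw [this, mul_one]
  · exact Continuous.intervalIntegrable (by fun_prop) _ _
  · refine ae_of_all _ fun ξ _ y _ => ?_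
    have h1 : HasDerivAt (fun y : ℝ => 2 * Real.pi * Complex.I * ((y : ℂ) * ξ))
        (2 * Real.pi * Complex.I * (1 * ξ)) y :=
      ((Complex.ofRealCLM.hasDerivAt (x := y)).mul_const (ξ : ℂ)).const_mul _
    have h2 := (h1.cexp).const_mul ((2 * Real.pi * Complex.I * (ξ : ℂ)) ^ r)
    refine h2.congr_deriv ?_
    rw [pow_succ, one_mul]
    ring

theorem bandKernel_zero (x : ℝ) : bandKernel 0 x = (nsinc x : ℂ) := by
  unfold bandKernel nsinc
  by_cases hx : x = 0
  · subst hx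
    simp
    norm_num
  · have hne : (2 * Real.pi * Complex.I * x : ℂ) ≠ 0 := by
      simp [hx, Real.pi_ne_zero]
    have : ∀ ξ : ℝ, (2 * Real.pi * Complex.I * ξ : ℂ) ^ 0 *
        Complex.exp (2 * Real.pi * Complex.I * (x * ξ)) =
        Complex.exp ((2 * Real.pi * Complex.I * x) * ξ) := by
      intro ξ; rw [pow_zero, one_mul]; ring_nf
    simp_rw [this]
    rw [integral_exp_mul_complex hne, Real.sinc_of_ne_zero (by simp [hx, Real.pi_ne_zero])]
    have e1 : (2 * Real.pi * Complex.I * x * ((1 / 2 : ℝ) : ℂ)) = (Real.pi * x : ℂ) * Complex.I := by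
      push_cast; ring
    have e2 : (2 * Real.pi * Complex.I * x * ((-(1 / 2) : ℝ) : ℂ)) =
        -(Real.pi * x : ℂ) * Complex.I := by
      push_cast; ring
    rw [e1, e2]
    push_cast
    rw [Complex.sin]
    have hpi : (Real.pi : ℂ) ≠ 0 := by simp [Real.pi_ne_zero]
    have hx' : (x : ℂ) ≠ 0 := by simpa using hx
    field_simp
    rw [Complex.I_sq]
    ring

theorem iteratedDeriv_nsinc (r : ℕ) (x : ℝ) :
    ((iteratedDeriv r nsinc x : ℝ) : ℂ) = bandKernel r x := by
  induction r generalizing x with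
  | zero => rw [iteratedDeriv_zero, bandKernel_zero]
  | succ r ih =>
    have hfun : iteratedDeriv r nsinc = fun y => (bandKernel r y).re := by
      ext y; rw [← ih y, Complex.ofReal_re]
    -- The kernel is complex-valued a priori; its imaginary part vanishes identically, hence so does
    -- that of its derivative.
    have him : (fun y => (bandKernel r y).im) = fun _ => 0 := by
      ext y; rw [← ih y, Complex.ofReal_im]
    have h1 := (Complex.reCLM.hasFDerivAt.comp_hasDerivAt x (hasDerivAt_bandKernel r x))
    have h2 := (Complex.imCLM.hasFDerivAt.comp_hasDerivAt x (hasDerivAt_bandKernel r x))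
    have h3 : (bandKernel (r + 1) x).im = 0 := by
      have h4 : HasDerivAt (fun y => (bandKernel r y).im) (bandKernel (r + 1) x).im x := h2
      rw [him] at h4
      exact h4.unique (hasDerivAt_const x 0)
    have h5 : HasDerivAt (iteratedDeriv r nsinc) (bandKernel (r + 1) x).re x := by
      rw [hfun]; exact h1
    rw [iteratedDeriv_succ, h5.deriv]
    apply Complex.ext <;> simp [h3]

/-! ### Fourier series of the derivative multipliers. -/

/-- The Fourier series of a `C²` function on `[-1/2, 1/2]` with equal boundary values converges
absolutely, and to the function itself. -/
theorem fourierSeries_of_eq_endpoints {φ φ' φ'' : ℝ → ℂ}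
    (h1 : ∀ x, HasDerivAt φ (φ' x) x) (h2 : ∀ x, HasDerivAt φ' (φ'' x) x)
    (h3 : Continuous φ'') (hper : φ (-(1 / 2)) = φ (1 / 2)) {c : ℤ → ℂ}
    (hc : ∀ k, c k = ∫ ξ in (-(1 / 2) : ℝ)..(1 / 2),
      Complex.exp (-(2 * Real.pi * Complex.I * (k * ξ))) * φ ξ) :
    Summable c ∧ ∀ ξ ∈ Set.Icc (-(1 / 2) : ℝ) (1 / 2),
      HasSum (fun k : ℤ => c k * Complex.exp (2 * Real.pi * Complex.I * (k * ξ))) (φ ξ) := by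
  have hab : (-(1 / 2) : ℝ) < -(1 / 2) + 1 := by norm_num
  have hb : (-(1 / 2) : ℝ) + 1 = 1 / 2 := by norm_num
  have hcoef : ∀ (ψ : ℝ → ℂ) (k : ℤ), fourierCoeffOn hab ψ k =
      ∫ ξ in (-(1 / 2) : ℝ)..(1 / 2), Complex.exp (-(2 * Real.pi * Complex.I * (k * ξ))) * ψ ξ := by
    intro ψ k
    rw [fourierCoeffOn_eq_integral]
    have e : ∀ ξ : ℝ, fourier (-k) (ξ : AddCircle ((-(1 / 2) : ℝ) + 1 - -(1 / 2))) • ψ ξ =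
        Complex.exp (-(2 * Real.pi * Complex.I * (k * ξ))) * ψ ξ := by
      intro ξ
      rw [fourier_coe_apply, smul_eq_mul]
      congr 2
      push_cast
      ring
    simp_rw [e, hb]
    norm_num
  have hc' : ∀ k, fourierCoeffOn hab φ k = c k := fun k => by rw [hcoef, hc]
  have hcont' : Continuous φ' := continuous_iff_continuousAt.2 fun x => (h2 x).continuousAt
  have hcont : Continuous φ := continuous_iff_continuousAt.2 fun x => (h1 x).continuousAt
  obtain ⟨M, hM⟩ : ∃ M, ∀ ξ ∈ Set.Icc (-(1 / 2) : ℝ) (1 / 2), ‖φ'' ξ‖ ≤ M :=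
    isCompact_Icc.exists_bound_of_continuousOn h3.continuousOn
  have hcoefM : ∀ k : ℤ, ‖fourierCoeffOn hab φ'' k‖ ≤ M := by
    intro k
    rw [hcoef]
    refine (intervalIntegral.norm_integral_le_of_norm_le_const (C := M) ?_).trans (by norm_num)
    intro ξ hξ
    rw [Set.uIoc_of_le (by norm_num)] at hξ
    have : ‖Complex.exp (-(2 * Real.pi * Complex.I * (k * ξ)))‖ = 1 := by
      have := Complex.norm_exp_ofReal_mul_I (-(2 * Real.pi * (k * ξ)))
      rw [← this]; congr 2; push_cast; ring
    rw [norm_mul, this, one_mul]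
    exact hM ξ ⟨hξ.1.le, hξ.2⟩
  -- Two integrations by parts: equal endpoint values kill the first boundary term, which leaves
  -- `O(1 / k²)` even though `φ'` may jump.
  have hbound : ∀ k : ℤ, k ≠ 0 →
      ‖c k‖ ≤ (‖φ' (1 / 2) - φ' (-(1 / 2))‖ + M) * (1 / (k : ℝ) ^ 2) := by
    intro k hk
    have i1 : IntervalIntegrable φ' volume (-(1 / 2)) (-(1 / 2) + 1) :=
      hcont'.intervalIntegrable _ _
    have i2 : IntervalIntegrable φ'' volume (-(1 / 2)) (-(1 / 2) + 1) :=
      h3.intervalIntegrable _ _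
    have e1 := fourierCoeffOn_of_hasDerivAt hab hk (fun x _ => h1 x) i1
    have e2 := fourierCoeffOn_of_hasDerivAt hab hk (fun x _ => h2 x) i2
    rw [hc'] at e1
    have hx : (((-(1 / 2) + 1 : ℝ) : ℂ) - ((-(1 / 2) : ℝ) : ℂ)) = 1 := by norm_num
    rw [hx, one_mul, congrArg φ hb, hper, sub_self, mul_zero, zero_sub] at e1
    rw [hx, one_mul, congrArg φ' hb] at e2
    rw [e1, e2]
    have hk' : (1 : ℝ) ≤ |(k : ℝ)| := by
      exact_mod_cast Int.one_le_abs hk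
    have hn : ‖(1 : ℂ) / (-2 * Real.pi * Complex.I * k)‖ ≤ 1 / |(k : ℝ)| := by
      rw [norm_div]
      simp only [norm_mul, norm_neg, Complex.norm_I, norm_one, Complex.norm_real, mul_one,
        Complex.norm_intCast, Complex.norm_ofNat, Real.norm_eq_abs, abs_of_pos Real.pi_pos]
      apply one_div_le_one_div_of_le (by linarith)
      have := Real.pi_gt_three
      nlinarith
    rw [norm_mul, norm_neg, norm_mul]
    calc _ ≤ 1 / |(k : ℝ)| * (1 / |(k : ℝ)| * (‖φ' (1 / 2) - φ' (-(1 / 2))‖ + M)) := by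
          gcongr
          refine (norm_sub_le _ _).trans ?_
          gcongr
          · rw [norm_mul]
            rw [fourier_apply, Circle.norm_coe, one_mul]
          · exact hcoefM k
      _ = _ := by
          rw [← sq_abs]; field_simp
  have hsum : Summable c := by
    have hs : Summable fun k : ℤ => (‖φ' (1 / 2) - φ' (-(1 / 2))‖ + M) * (1 / (k : ℝ) ^ 2) :=
      (Real.summable_one_div_int_pow.2 (by norm_num : 1 < 2)).mul_left _
    refine Summable.of_norm_bounded_eventually hs ?_
    have : {k : ℤ | ¬ ‖c k‖ ≤ (‖φ' (1 / 2) - φ' (-(1 / 2))‖ + M) * (1 / (k : ℝ) ^ 2)} ⊆ {0} := by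
      intro k hk
      by_contra h0
      exact hk (hbound k h0)
    exact (Set.finite_singleton (0 : ℤ)).subset this
  refine ⟨hsum, ?_⟩
  have : Fact ((0 : ℝ) < 1) := ⟨one_pos⟩
  let Φ : C(AddCircle (1 : ℝ), ℂ) := ⟨AddCircle.liftIco 1 (-(1 / 2)) φ,
    AddCircle.liftIco_continuous (by rw [hb, hper]) hcont.continuousOn⟩
  have hΦ : fourierCoeff Φ = c := by
    ext k
    rw [← hc' k]
    exact fourierCoeff_liftIco_eq φ k
  have hpt : ∀ ξ ∈ Set.Ico (-(1 / 2) : ℝ) (1 / 2),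
      HasSum (fun k : ℤ => c k * Complex.exp (2 * Real.pi * Complex.I * (k * ξ))) (φ ξ) := by
    intro ξ hξ
    have h := has_pointwise_sum_fourier_series_of_summable (f := Φ) (by rw [hΦ]; exact hsum)
      (ξ : AddCircle (1 : ℝ))
    have hv : Φ (ξ : AddCircle (1 : ℝ)) = φ ξ :=
      AddCircle.liftIco_coe_apply (by rw [hb]; exact hξ)
    rw [hv, hΦ] at h
    convert h using 2 with k
    rw [fourier_coe_apply, smul_eq_mul]
    congr 2
    push_cast
    ring
  intro ξ hξ
  rcases eq_or_lt_of_le hξ.2 with h | h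
  · have h0 := hpt (-(1 / 2)) ⟨le_rfl, by norm_num⟩
    rw [h, ← hper]
    convert h0 using 3 with k
    rw [show (2 * Real.pi * Complex.I * (k * ((1 / 2 : ℝ) : ℂ))) =
      2 * Real.pi * Complex.I * (k * ((-(1 / 2) : ℝ) : ℂ)) + k * (2 * Real.pi * Complex.I) by
        push_cast; ring]
    rw [Complex.exp_periodic.int_mul k]
  · exact hpt ξ ⟨hξ.1, h⟩

/-- Shifts `a` for which the nodes `k - a`, `k ∈ ℤ`, are used to compute `r`-th derivatives. -/
def IsNodeShift (r : ℕ) (a : ℝ) : Prop :=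
  (a = 0 ∧ Even r) ∨ (a = 1 / 2 ∧ Odd r)

/-- The numbers `bandKernel r (a - k)` are the Fourier coefficients of `(2πiξ) ^ r * exp (2πiaξ)`.
The shift makes the values at `±1/2` agree: an even power is symmetric, and for an odd power with `a
= 1 / 2` the exponentials are `±i`, which compensates the sign. -/
theorem bandKernel_series {r : ℕ} {a : ℝ} (h : IsNodeShift r a) :
    Summable (fun k : ℤ => bandKernel r (a - k)) ∧ ∀ ξ ∈ Set.Icc (-(1 / 2) : ℝ) (1 / 2),
      HasSum (fun k : ℤ => bandKernel r (a - k) *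
        Complex.exp (2 * Real.pi * Complex.I * ((k - a) * ξ)))
        ((2 * Real.pi * Complex.I * ξ) ^ r) := by
  set φ : ℂ → ℂ := fun ξ => (2 * Real.pi * Complex.I * ξ) ^ r *
    Complex.exp (2 * Real.pi * Complex.I * (a * ξ)) with hφ
  have hd : ContDiff ℂ 2 φ := by rw [hφ]; fun_prop
  have h1 : ∀ z, HasDerivAt φ (deriv φ z) z := fun z =>
    (hd.differentiable (by norm_num) z).hasDerivAt
  have hd1 : ContDiff ℂ 1 (deriv φ) := by
    have : ContDiff ℂ (1 + 1) φ := by norm_num; exact hd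
    exact (contDiff_succ_iff_deriv.1 this).2.2
  have h2 : ∀ z, HasDerivAt (deriv φ) (deriv (deriv φ) z) z := fun z =>
    (hd1.differentiable (by norm_num) z).hasDerivAt
  have h3 : Continuous (deriv (deriv φ)) := hd1.continuous_deriv (by norm_num)
  have hper : φ ((-(1 / 2) : ℝ) : ℂ) = φ ((1 / 2 : ℝ) : ℂ) := by
    rcases h with ⟨rfl, hr⟩ | ⟨rfl, hr⟩
    · simp only [hφ]
      push_cast
      rw [mul_neg, hr.neg_pow]
      simp
    · simp only [hφ]
      push_cast
      rw [mul_neg, hr.neg_pow]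
      have e1 : (2 * Real.pi * Complex.I * (1 / 2 * -(1 / 2)) : ℂ) = -(Real.pi / 2 * Complex.I) := by
        ring
      have e2 : (2 * Real.pi * Complex.I * (1 / 2 * (1 / 2)) : ℂ) = (Real.pi / 2 * Complex.I) := by
        ring
      rw [e1, e2, Complex.exp_neg, Complex.exp_pi_div_two_mul_I, Complex.inv_I]
      ring
  have key := fourierSeries_of_eq_endpoints (φ := fun x : ℝ => φ x)
    (fun x => (h1 x).comp_ofReal) (fun x => (h2 x).comp_ofReal)
    (h3.comp Complex.continuous_ofReal) hper (c := fun k => bandKernel r (a - k)) (by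
      intro k
      unfold bandKernel
      refine intervalIntegral.integral_congr fun ξ _ => ?_
      simp only [hφ]
      have e : Complex.exp (2 * Real.pi * Complex.I * ((a - k : ℝ) * ξ)) =
          Complex.exp (-(2 * Real.pi * Complex.I * (k * ξ))) *
            Complex.exp (2 * Real.pi * Complex.I * (a * ξ)) := by
        rw [← Complex.exp_add]
        congr 1
        push_cast
        ring
      rw [e]
      ring)
  refine ⟨key.1, fun ξ hξ => ?_⟩
  have := (key.2 ξ hξ).mul_right (Complex.exp (-(2 * Real.pi * Complex.I * (a * ξ))))
  simp only [hφ] at this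
  have e : ∀ k : ℤ, Complex.exp (2 * Real.pi * Complex.I * ((k - a) * ξ)) =
      Complex.exp (2 * Real.pi * Complex.I * (k * ξ)) *
        Complex.exp (-(2 * Real.pi * Complex.I * (a * ξ))) := by
    intro k
    rw [← Complex.exp_add]
    congr 1
    ring
  simp_rw [e, ← mul_assoc]
  simp_rw [← mul_assoc] at this
  rwa [mul_assoc _ (Complex.exp _) (Complex.exp _), ← Complex.exp_add, add_neg_cancel,
    Complex.exp_zero, mul_one] at this

/-! ### Growth off the real axis. -/

/-- Phragmén–Lindelöf, after rotating the upper half-plane to the right one. The factor `exp (-(τ +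
ε) w)` makes the function bounded on the positive real axis and has modulus one on the imaginary
axis. -/
theorem IsEntireOfExpType.norm_le_of_im_nonneg {F : ℂ → ℂ} {τ M ε : ℝ}
    (hF : IsEntireOfExpType τ F) (hM : ∀ t : ℝ, ‖F t‖ ≤ M) (hε : 0 < ε) {z : ℂ} (hz : 0 ≤ z.im) :
    ‖F z‖ ≤ M * Real.exp ((τ + ε) * z.im) := by
  obtain ⟨C, hC⟩ := hF.2 ε hε
  set h : ℂ → ℂ := fun w => F (Complex.I * w) * Complex.exp (-((τ + ε : ℝ) : ℂ) * w) with hh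
  have hd : Differentiable ℂ h := by
    have h1 : Differentiable ℂ fun w : ℂ => F (Complex.I * w) :=
      hF.1.comp (differentiable_id.const_mul _)
    exact h1.mul (by fun_prop)
  have hnorm : ∀ w : ℂ, ‖h w‖ = ‖F (Complex.I * w)‖ * Real.exp (-(τ + ε) * w.re) := by
    intro w
    rw [hh]
    simp only [norm_mul, Complex.norm_exp]
    congr 2
    simp
  have key : ‖h (-Complex.I * z)‖ ≤ M := by
    refine PhragmenLindelof.right_half_plane_of_bounded_on_real hd.diffContOnCl
      ⟨1, by norm_num, (τ + ε) + |τ + ε|, ?_⟩ ?_ ?_ ?_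
    · refine Asymptotics.IsBigO.of_bound C (Eventually.of_forall fun w => ?_)
      rw [hnorm, Real.rpow_one, Real.norm_eq_abs, Real.abs_exp, add_mul, Real.exp_add]
      have h1 : ‖F (Complex.I * w)‖ ≤ C * Real.exp ((τ + ε) * ‖w‖) := by
        have := hC (Complex.I * w)
        rwa [norm_mul, Complex.norm_I, one_mul] at this
      have h2 : Real.exp (-(τ + ε) * w.re) ≤ Real.exp (|τ + ε| * ‖w‖) := by
        apply Real.exp_le_exp.2
        calc _ ≤ |-(τ + ε) * w.re| := le_abs_self _
          _ = |τ + ε| * |w.re| := by rw [abs_mul, abs_neg]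
          _ ≤ _ := by gcongr; exact Complex.abs_re_le_norm w
      calc _ ≤ (C * Real.exp ((τ + ε) * ‖w‖)) * Real.exp (|τ + ε| * ‖w‖) :=
            mul_le_mul h1 h2 (Real.exp_pos _).le ((norm_nonneg _).trans h1)
        _ = _ := by ring
    · refine isBoundedUnder_of_eventually_le (a := C) ?_
      filter_upwards [eventually_ge_atTop (0 : ℝ)] with x hx
      rw [hnorm]
      have h1 := hC (Complex.I * x)
      rw [norm_mul, Complex.norm_I, one_mul, Complex.norm_real, Real.norm_eq_abs,
        abs_of_nonneg hx] at h1
      calc _ ≤ (C * Real.exp ((τ + ε) * x)) * Real.exp (-(τ + ε) * (x : ℂ).re) := by gcongr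
        _ = C := by
          rw [mul_assoc, ← Real.exp_add, Complex.ofReal_re, neg_mul, add_neg_cancel,
            Real.exp_zero, mul_one]
    · intro x
      rw [hnorm]
      have : Complex.I * (x * Complex.I) = ((-x : ℝ) : ℂ) := by
        push_cast
        linear_combination (x : ℂ) * Complex.I_mul_I
      rw [this]
      simpa using hM (-x)
    · simpa using hz
  rw [hnorm] at key
  have e1 : Complex.I * (-Complex.I * z) = z := by
    linear_combination (-z) * Complex.I_mul_I
  have e2 : (-Complex.I * z).re = z.im := by simp
  rw [e1, e2] at key
  calc ‖F z‖ = ‖F z‖ * Real.exp (-(τ + ε) * z.im) * Real.exp ((τ + ε) * z.im) := by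
        rw [mul_assoc, ← Real.exp_add, neg_mul, neg_add_cancel, Real.exp_zero, mul_one]
    _ ≤ _ := by gcongr

/-- An entire function of exponential type `τ` that is bounded by `M` on the real axis is
bounded by `M * exp (τ |Im z|)`. -/
theorem IsEntireOfExpType.norm_le {F : ℂ → ℂ} {τ M : ℝ}
    (hF : IsEntireOfExpType τ F) (hM : ∀ t : ℝ, ‖F t‖ ≤ M) (z : ℂ) :
    ‖F z‖ ≤ M * Real.exp (τ * |z.im|) := by
  have key : ∀ ε > 0, ‖F z‖ ≤ M * Real.exp ((τ + ε) * |z.im|) := by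
    intro ε hε
    rcases le_total 0 z.im with hz | hz
    · rw [abs_of_nonneg hz]
      exact hF.norm_le_of_im_nonneg hM hε hz
    · have hG : IsEntireOfExpType τ fun w => F (-w) :=
        ⟨hF.1.comp differentiable_neg, fun ε hε => by
          obtain ⟨C, hC⟩ := hF.2 ε hε
          exact ⟨C, fun w => by simpa using hC (-w)⟩⟩
      have := hG.norm_le_of_im_nonneg (M := M) (fun t => by simpa using hM (-t)) hε
        (z := -z) (by simpa using hz)
      rw [abs_of_nonpos hz]
      simpa using this
  have hlim : Tendsto (fun ε : ℝ => M * Real.exp ((τ + ε) * |z.im|)) (𝓝[>] 0)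
      (𝓝 (M * Real.exp ((τ + 0) * |z.im|))) := by
    apply tendsto_nhdsWithin_of_tendsto_nhds
    exact Continuous.tendsto (by fun_prop) 0
  rw [add_zero] at hlim
  exact ge_of_tendsto hlim (eventually_nhdsWithin_of_forall key)

/-! ### Spectrum and sampling of integrable functions of type `π`. -/

/-- Cauchy's theorem on the rectangle `[-N, N] × [-N, 0]`: the bottom side contributes `O(N exp
(-δN))` and the vertical sides `O(1 / N)`. -/
theorem integral_eq_zero_of_lower_decay {G : ℂ → ℂ} {C δ : ℝ} (hG : Differentiable ℂ G)
    (hδ : 0 < δ) (hC : ∀ z : ℂ, z.im ≤ 0 → ‖G z‖ ≤ C * Real.exp (δ * z.im) / (1 + z.re ^ 2)) :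
    ∫ x : ℝ, G x = 0 := by
  have hcont : Continuous fun x : ℝ => G x := hG.continuous.comp Complex.continuous_ofReal
  have hC0 : 0 ≤ C := by
    have := (norm_nonneg _).trans (hC 0 (by simp))
    simpa using this
  have hint : Integrable fun x : ℝ => G x := by
    refine (integrable_inv_one_add_sq.const_mul C).mono' hcont.aestronglyMeasurable
      (ae_of_all _ fun x => ?_)
    have := hC x (by simp)
    simpa [div_eq_mul_inv] using this
  have hlim := intervalIntegral_tendsto_integral hint tendsto_neg_atTop_atBot tendsto_id
  have hbound : ∀ N : ℝ, 0 < N → ‖∫ x in (-N)..N, G x‖ ≤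
      2 * C / δ * (δ * N * Real.exp (-(δ * N))) + 2 * C * N⁻¹ := by
    intro N hN
    have hrect := Complex.integral_boundary_rect_eq_zero_of_differentiableOn G
      (((-N : ℝ) : ℂ) + ((-N : ℝ) : ℂ) * Complex.I) (N : ℂ) hG.differentiableOn
    have a1 : (((-N : ℝ) : ℂ) + ((-N : ℝ) : ℂ) * Complex.I).re = -N := by simp
    have a2 : (((-N : ℝ) : ℂ) + ((-N : ℝ) : ℂ) * Complex.I).im = -N := by simp
    rw [a1, a2, Complex.ofReal_re, Complex.ofReal_im] at hrect
    simp only [Complex.ofReal_zero, zero_mul, add_zero] at hrect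
    have b1 : ‖∫ x in (-N)..N, G (x + ((-N : ℝ) : ℂ) * Complex.I)‖ ≤
        C * Real.exp (-(δ * N)) * |N - -N| := by
      refine intervalIntegral.norm_integral_le_of_norm_le_const fun x _ => ?_
      have := hC (x + ((-N : ℝ) : ℂ) * Complex.I) (by simp [hN.le])
      refine this.trans ?_
      simp only [Complex.add_im, Complex.ofReal_im, Complex.mul_im, Complex.ofReal_re,
        Complex.I_im, mul_one, Complex.I_re, mul_zero, add_zero, zero_add, mul_neg]
      refine div_le_self (by positivity) ?_
      have := sq_nonneg (x + ((-N : ℝ) : ℂ) * Complex.I).re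
      linarith
    have side : ∀ s : ℝ, s ^ 2 = N ^ 2 →
        ‖∫ y in (-N)..0, G ((s : ℂ) + y * Complex.I)‖ ≤ C / (1 + N ^ 2) * |0 - -N| := by
      intro s hs
      refine intervalIntegral.norm_integral_le_of_norm_le_const fun y hy => ?_
      rw [Set.uIoc_of_le (by linarith)] at hy
      have := hC ((s : ℂ) + y * Complex.I) (by simpa using hy.2)
      refine this.trans ?_
      simp only [Complex.add_im, Complex.ofReal_im, Complex.mul_im, Complex.ofReal_re,
        Complex.I_im, mul_one, Complex.I_re, mul_zero, add_zero, zero_add, Complex.add_re,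
        Complex.mul_re, sub_self, hs]
      gcongr
      have : Real.exp (δ * y) ≤ 1 := Real.exp_le_one_iff.2 (by nlinarith [hy.2])
      nlinarith
    have b2 := side N rfl
    have b3 := side (-N) (by ring)
    have e : ∫ x in (-N)..N, G x = (∫ x in (-N)..N, G (x + ((-N : ℝ) : ℂ) * Complex.I)) +
        Complex.I • (∫ y in (-N)..0, G ((N : ℂ) + y * Complex.I)) -
        Complex.I • (∫ y in (-N)..0, G (((-N : ℝ) : ℂ) + y * Complex.I)) := by
      rw [eq_comm, ← sub_eq_zero, ← hrect]
      ring
    rw [e]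
    refine (norm_sub_le _ _).trans ?_
    refine (add_le_add (norm_add_le _ _) le_rfl).trans ?_
    rw [norm_smul, norm_smul, Complex.norm_I, one_mul, one_mul]
    refine (add_le_add (add_le_add b1 b2) b3).trans ?_
    rw [abs_of_pos (by linarith), abs_of_pos (by linarith)]
    have h1 : C / (1 + N ^ 2) * (0 - -N) ≤ C * N⁻¹ := by
      rw [div_mul_eq_mul_div, mul_div_assoc]
      gcongr
      rw [div_le_iff₀ (by positivity)]
      field_simp
      nlinarith
    have h2 : C * Real.exp (-(δ * N)) * (N - -N) =
        2 * C / δ * (δ * N * Real.exp (-(δ * N))) := by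
      field_simp; ring
    rw [h2]
    linarith
  have hzero : Tendsto (fun N : ℝ => 2 * C / δ * (δ * N * Real.exp (-(δ * N))) + 2 * C * N⁻¹)
      atTop (𝓝 0) := by
    have h1 : Tendsto (fun N : ℝ => δ * N) atTop atTop := tendsto_id.const_mul_atTop hδ
    have h2 := (Real.tendsto_pow_mul_exp_neg_atTop_nhds_zero 1).comp h1
    have h3 := (h2.const_mul (2 * C / δ)).add (tendsto_inv_atTop_zero.const_mul (2 * C))
    simpa [Function.comp_def] using h3
  have := squeeze_zero_norm' (f := fun N : ℝ => ∫ x in (-N)..N, G x)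
    ((eventually_gt_atTop 0).mono hbound) hzero
  exact tendsto_nhds_unique hlim this

open FourierTransform in
-- For `ξ > 1 / 2` the exponential beats the growth of `F` in the lower half-plane, with rate `2πξ -
-- π`. The case `ξ < -1 / 2` reduces to it by `z ↦ -z`.
theorem fourier_eq_zero_of_decay {F : ℂ → ℂ} {C : ℝ} (hF : Differentiable ℂ F)
    (hC : ∀ z : ℂ, ‖F z‖ ≤ C * Real.exp (Real.pi * |z.im|) / (1 + z.re ^ 2))
    {ξ : ℝ} (hξ : 1 / 2 < |ξ|) : 𝓕 (fun x : ℝ => F x) ξ = 0 := by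
  have hpi := Real.pi_pos
  rw [Real.fourier_real_eq_integral_exp_smul]
  simp only [smul_eq_mul]
  have hnorm : ∀ z : ℂ, ∀ η : ℝ,
      ‖Complex.exp (((-2 * Real.pi * η : ℝ) : ℂ) * z * Complex.I)‖ =
        Real.exp (2 * Real.pi * η * z.im) := by
    intro z η
    rw [Complex.norm_exp]
    congr 1
    simp
  rcases lt_abs.1 hξ with h | h
  · have hG : Differentiable ℂ fun z : ℂ =>
        Complex.exp (((-2 * Real.pi * ξ : ℝ) : ℂ) * z * Complex.I) * F z :=
      Differentiable.mul (by fun_prop) hF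
    have := integral_eq_zero_of_lower_decay (C := C) hG
      (δ := 2 * Real.pi * ξ - Real.pi) (by nlinarith) (fun z hz => by
        rw [norm_mul, hnorm]
        refine (mul_le_mul_of_nonneg_left (hC z) (Real.exp_pos _).le).trans (le_of_eq ?_)
        rw [abs_of_nonpos hz, sub_mul, sub_eq_add_neg, Real.exp_add]
        ring_nf)
    rw [← this]
    refine integral_congr_ae (ae_of_all _ fun x => ?_)
    simp only
    congr 2
    push_cast
    ring
  · have hG : Differentiable ℂ fun z : ℂ =>
        Complex.exp (((-2 * Real.pi * (-ξ) : ℝ) : ℂ) * z * Complex.I) * F (-z) :=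
      Differentiable.mul (by fun_prop) (hF.comp differentiable_neg)
    have := integral_eq_zero_of_lower_decay (C := C) hG
      (δ := 2 * Real.pi * (-ξ) - Real.pi) (by nlinarith) (fun z hz => by
        rw [norm_mul, hnorm]
        refine (mul_le_mul_of_nonneg_left (hC (-z)) (Real.exp_pos _).le).trans (le_of_eq ?_)
        rw [Complex.neg_im, abs_neg, abs_of_nonpos hz, sub_mul, sub_eq_add_neg, Real.exp_add,
          Complex.neg_re]
        ring_nf)
    rw [← this, ← integral_neg_eq_self]
    refine integral_congr_ae (ae_of_all _ fun x => ?_)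
    simp only
    congr 2
    · push_cast
      ring
    · push_cast
      rfl

open FourierTransform in
/-- The sampling formula for derivatives of integrable functions of exponential type `π`. -/
theorem hasSum_iteratedDeriv_of_decay {F : ℂ → ℂ} {C : ℝ} (hF : Differentiable ℂ F)
    (hC : ∀ z : ℂ, ‖F z‖ ≤ C * Real.exp (Real.pi * |z.im|) / (1 + z.re ^ 2))
    {r : ℕ} {a : ℝ} (h : IsNodeShift r a) :
    HasSum (fun k : ℤ => bandKernel r (a - k) * F ((k - a : ℝ) : ℂ))
      (iteratedDeriv r (fun t : ℝ => F t) 0) := by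
  set f : ℝ → ℂ := fun x => F x with hf
  have hcont : Continuous f := hF.continuous.comp Complex.continuous_ofReal
  have hint : Integrable f := by
    refine (integrable_inv_one_add_sq.const_mul C).mono' hcont.aestronglyMeasurable
      (ae_of_all _ fun x => ?_)
    have := hC x
    simpa [div_eq_mul_inv] using this
  have hFc : Continuous (𝓕 f) := by
    refine VectorFourier.fourierIntegral_continuous Real.continuous_fourierChar ?_ hint
    exact continuous_inner
  have hsupp : ∀ ξ ∉ Set.Icc (-(1 / 2) : ℝ) (1 / 2), 𝓕 f ξ = 0 := by
    intro ξ hξ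
    refine fourier_eq_zero_of_decay hF hC ?_
    by_contra hcon
    exact hξ (abs_le.1 (not_lt.1 hcon))
  have hcs : HasCompactSupport (𝓕 f) := HasCompactSupport.intro isCompact_Icc hsupp
  have hinv := hcont.fourierInv_fourier_eq hint (hFc.integrable_of_hasCompactSupport hcs)
  -- The reflection presents `f` as a forward Fourier transform, so that it can be differentiated
  -- under the integral.
  set g : ℝ → ℂ := fun ξ => 𝓕 f (-ξ) with hg
  have hgc : Continuous g := hFc.comp continuous_neg
  have hgsupp : ∀ ξ ∉ Set.Icc (-(1 / 2) : ℝ) (1 / 2), g ξ = 0 := by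
    intro ξ hξ
    refine hsupp _ fun hcon => hξ ⟨by linarith [hcon.2], by linarith [hcon.1]⟩
  have hgcs : HasCompactSupport g := HasCompactSupport.intro isCompact_Icc hgsupp
  have hfg : f = 𝓕 g := by
    rw [← hinv, Real.fourierInv_eq_fourier_comp_neg]
  have hinterval : ∀ ψ : ℝ → ℂ,
      ∫ ξ, ψ ξ * g ξ = ∫ ξ in (-(1 / 2) : ℝ)..(1 / 2), ψ ξ * g ξ := by
    intro ψ
    rw [intervalIntegral.integral_of_le (by norm_num), ← integral_Icc_eq_integral_Ioc]
    refine (setIntegral_eq_integral_of_forall_compl_eq_zero fun ξ hξ => ?_).symm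
    rw [hgsupp ξ hξ, mul_zero]
  have hval : ∀ x : ℝ, F x = ∫ ξ in (-(1 / 2) : ℝ)..(1 / 2),
      Complex.exp (2 * Real.pi * Complex.I * (x * ((-ξ : ℝ) : ℂ))) * g ξ := by
    intro x
    have : F x = 𝓕 g x := congrFun hfg x
    rw [this, Real.fourier_real_eq_integral_exp_smul, ← hinterval]
    refine integral_congr_ae (ae_of_all _ fun ξ => ?_)
    simp only [smul_eq_mul]
    congr 2
    push_cast
    ring
  have hder : iteratedDeriv r f 0 = ∫ ξ in (-(1 / 2) : ℝ)..(1 / 2),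
      (2 * Real.pi * Complex.I * ((-ξ : ℝ) : ℂ)) ^ r * g ξ := by
    rw [hfg, Real.iteratedDeriv_fourier (N := ⊤) (fun n _ => ?_) le_top,
      Real.fourier_real_eq_integral_exp_smul, ← hinterval]
    · refine integral_congr_ae (ae_of_all _ fun ξ => ?_)
      simp
    · refine Continuous.integrable_of_hasCompactSupport (by fun_prop) ?_
      exact hgcs.smul_left
  rw [hder]
  obtain ⟨hs, hsum⟩ := bandKernel_series h
  have hexp : ∀ (x ξ : ℝ), ‖Complex.exp (2 * Real.pi * Complex.I * (x * (ξ : ℂ)))‖ = 1 := by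
    intro x ξ
    have := Complex.norm_exp_ofReal_mul_I (2 * Real.pi * (x * ξ))
    rw [← this]; congr 2; push_cast; ring
  -- Insert the Fourier series of the multiplier and integrate term by term; absolute summability of
  -- the kernel values supplies the dominating sum.
  have key := intervalIntegral.hasSum_integral_of_dominated_convergence (μ := volume)
    (a := -(1 / 2)) (b := 1 / 2)
    (F := fun (k : ℤ) (ξ : ℝ) => bandKernel r (a - k) *
      (Complex.exp (2 * Real.pi * Complex.I * (((k - a : ℝ) : ℂ) * ((-ξ : ℝ) : ℂ))) * g ξ))
    (f := fun ξ : ℝ => (2 * Real.pi * Complex.I * ((-ξ : ℝ) : ℂ)) ^ r * g ξ)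
    (fun k ξ => ‖bandKernel r (a - k)‖ * ‖g ξ‖)
    (fun k => Continuous.aestronglyMeasurable (by fun_prop))
    (fun k => ae_of_all _ fun ξ _ => by
      rw [norm_mul, norm_mul, hexp, one_mul])
    (ae_of_all _ fun ξ _ => hs.norm.mul_right _)
    (by
      simp_rw [tsum_mul_right]
      exact Continuous.intervalIntegrable (by fun_prop) _ _)
    (ae_of_all _ fun ξ hξ => by
      rw [Set.uIoc_of_le (by norm_num)] at hξ
      have := (hsum (-ξ) ⟨by linarith [hξ.2], by linarith [hξ.1]⟩).mul_right (g ξ)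
      simpa only [mul_assoc, Complex.ofReal_sub, Complex.ofReal_intCast] using this)
  simp_rw [intervalIntegral.integral_const_mul, ← hval] at key
  exact key

/-! ### Removing the decay assumption by a sinc multiplier. -/

theorem norm_sin_le_exp_abs_im (z : ℂ) : ‖Complex.sin z‖ ≤ Real.exp |z.im| := by
  rw [Complex.sin, norm_div, norm_mul, Complex.norm_I, mul_one, Complex.norm_ofNat,
    div_le_iff₀ two_pos]
  refine (norm_sub_le _ _).trans ?_
  rw [Complex.norm_exp, Complex.norm_exp]
  have h1 : (-z * Complex.I).re ≤ |z.im| := by simpa using le_abs_self z.im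
  have h2 : (z * Complex.I).re ≤ |z.im| := by simpa using neg_le_abs z.im
  have := Real.exp_le_exp.2 h1
  have := Real.exp_le_exp.2 h2
  linarith

/-- The entire function `sin z / z`. -/
def entireSinc : ℂ → ℂ := dslope Complex.sin 0

theorem differentiable_entireSinc : Differentiable ℂ entireSinc := by
  rw [← differentiableOn_univ]
  exact (Complex.differentiableOn_dslope univ_mem).2 Complex.differentiable_sin.differentiableOn

theorem entireSinc_zero : entireSinc 0 = 1 := by
  simp [entireSinc, dslope_same]

theorem exists_entireSinc_bound :
    ∃ C : ℝ, 0 < C ∧ ∀ z : ℂ, (1 + ‖z‖ ^ 2) * ‖entireSinc z‖ ^ 2 ≤ C * Real.exp (2 * |z.im|) := by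
  obtain ⟨B, hB⟩ := (isCompact_closedBall (0 : ℂ) 1).exists_bound_of_continuousOn
    differentiable_entireSinc.continuous.continuousOn
  refine ⟨2 * B ^ 2 + 2, by positivity, fun z => ?_⟩
  have hmul : ‖z‖ * ‖entireSinc z‖ ≤ Real.exp |z.im| := by
    have : z * entireSinc z = Complex.sin z := by
      have := sub_smul_dslope Complex.sin 0 z
      simpa [entireSinc] using this
    rw [← norm_mul, this]
    exact norm_sin_le_exp_abs_im z
  have he : Real.exp (2 * |z.im|) = Real.exp |z.im| ^ 2 := by
    rw [← Real.exp_nat_mul]; norm_num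
  have h1 : (1 : ℝ) ≤ Real.exp |z.im| := Real.one_le_exp (abs_nonneg _)
  have h2 : (‖z‖ * ‖entireSinc z‖) ^ 2 ≤ Real.exp |z.im| ^ 2 := by gcongr
  rw [he]
  rcases le_total ‖z‖ 1 with hz | hz
  · have h3 : ‖entireSinc z‖ ^ 2 ≤ B ^ 2 := by
      gcongr
      exact hB z (by simpa using hz)
    have h4 : (1 : ℝ) ≤ Real.exp |z.im| ^ 2 := one_le_pow₀ h1
    nlinarith [sq_nonneg B]
  · have h3 : ‖entireSinc z‖ ^ 2 ≤ (‖z‖ * ‖entireSinc z‖) ^ 2 := by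
      gcongr
      exact le_mul_of_one_le_left (norm_nonneg _) hz
    nlinarith [sq_nonneg B, sq_nonneg (Real.exp |z.im|)]

theorem contDiff_real_restriction {F : ℂ → ℂ} (hF : Differentiable ℂ F) {n : WithTop ℕ∞} :
    ContDiff ℝ n fun t : ℝ => F t :=
  (hF.contDiff.restrict_scalars ℝ).comp Complex.ofRealCLM.contDiff

/-- The sampling formula for derivatives of bounded functions of exponential type `π`. -/
theorem hasSum_iteratedDeriv_of_memBernstein {u : ℝ → ℂ} (hu : MemBernstein Real.pi u)
    {r : ℕ} {a : ℝ} (h : IsNodeShift r a) :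
    HasSum (fun k : ℤ => bandKernel r (a - k) * u (k - a)) (iteratedDeriv r u 0) := by
  obtain ⟨⟨F, hF, hFu⟩, M, hM⟩ := hu
  have hFM : ∀ t : ℝ, ‖F t‖ ≤ M := fun t => by rw [hFu]; exact hM t
  have hM0 : 0 ≤ M := (norm_nonneg _).trans (hM 0)
  obtain rfl : (fun t : ℝ => F t) = u := funext hFu
  obtain ⟨C, hC0, hC⟩ := exists_entireSinc_bound
  have hpi := Real.pi_pos
  have hdF := hF.1
  have hcF := hF.1.continuous
  have hs := differentiable_entireSinc
  have hcs := differentiable_entireSinc.continuous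
  obtain ⟨hsum, -⟩ := bandKernel_series h
  -- Dilating by `1 - 2ε` lowers the type to `π(1 - 2ε)`, exactly making room for the squared sinc
  -- of type `2πε`, which supplies quadratic decay.
  let G : ℝ → ℂ → ℂ := fun ε z =>
    F ((1 - 2 * ε : ℝ) * z) * entireSinc ((Real.pi * ε : ℝ) * z) ^ 2
  have hG : ∀ ε, Differentiable ℂ (G ε) := fun ε =>
    (hdF.comp (differentiable_id.const_mul _)).mul ((hs.comp (differentiable_id.const_mul _)).pow 2)
  have hG0 : ∀ z, G 0 z = F z := fun z => by simp [G, entireSinc_zero]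
  have hformula : ∀ ε ∈ Set.Ioo (0 : ℝ) (1 / 2),
      HasSum (fun k : ℤ => bandKernel r (a - k) * G ε ((k - a : ℝ) : ℂ))
        (iteratedDeriv r (fun t : ℝ => G ε t) 0) := by
    intro ε hε
    refine hasSum_iteratedDeriv_of_decay (C := M * C / ε ^ 2) (hG ε) (fun z => ?_) h
    have h1 := hF.norm_le hFM ((1 - 2 * ε : ℝ) * z)
    have h2 := hC ((Real.pi * ε : ℝ) * z)
    rw [Complex.im_ofReal_mul, abs_mul, abs_of_pos (by linarith [hε.2])] at h1
    rw [Complex.im_ofReal_mul, abs_mul, abs_of_pos (mul_pos hpi hε.1), norm_mul, Complex.norm_real,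
      Real.norm_eq_abs, abs_of_pos (mul_pos hpi hε.1)] at h2
    have hε0 := hε.1
    have h3 : ε ^ 2 * (1 + z.re ^ 2) ≤ 1 + (Real.pi * ε * ‖z‖) ^ 2 := by
      have a1 : z.re ^ 2 ≤ ‖z‖ ^ 2 := by
        rw [← sq_abs]; gcongr; exact Complex.abs_re_le_norm z
      have a2 : ε ^ 2 ≤ 1 := by nlinarith [hε.2]
      have a3 : (1 : ℝ) ≤ Real.pi ^ 2 := by nlinarith [Real.pi_gt_three]
      have a4 : ε ^ 2 * z.re ^ 2 ≤ Real.pi ^ 2 * (ε ^ 2 * ‖z‖ ^ 2) := by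
        have : ε ^ 2 * z.re ^ 2 ≤ ε ^ 2 * ‖z‖ ^ 2 := by gcongr
        nlinarith [mul_nonneg (sq_nonneg ε) (sq_nonneg ‖z‖)]
      nlinarith
    have h4 : ε ^ 2 * (1 + z.re ^ 2) * ‖entireSinc ((Real.pi * ε : ℝ) * z)‖ ^ 2 ≤
        C * Real.exp (2 * (Real.pi * ε * |z.im|)) :=
      (mul_le_mul_of_nonneg_right h3 (by positivity)).trans h2
    have h5 : ‖entireSinc ((Real.pi * ε : ℝ) * z)‖ ^ 2 ≤
        C * Real.exp (2 * (Real.pi * ε * |z.im|)) / (ε ^ 2 * (1 + z.re ^ 2)) := by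
      rw [le_div_iff₀ (by positivity), mul_comm]
      exact h4
    calc ‖G ε z‖ = ‖F ((1 - 2 * ε : ℝ) * z)‖ * ‖entireSinc ((Real.pi * ε : ℝ) * z)‖ ^ 2 := by
          simp only [G, norm_mul, norm_pow]
      _ ≤ M * Real.exp (Real.pi * ((1 - 2 * ε) * |z.im|)) *
          (C * Real.exp (2 * (Real.pi * ε * |z.im|)) / (ε ^ 2 * (1 + z.re ^ 2))) := by gcongr
      _ = M * C * (Real.exp (Real.pi * ((1 - 2 * ε) * |z.im|)) *
          Real.exp (2 * (Real.pi * ε * |z.im|))) / (ε ^ 2 * (1 + z.re ^ 2)) := by ring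
      _ = M * C * Real.exp (Real.pi * |z.im|) / (ε ^ 2 * (1 + z.re ^ 2)) := by
          rw [← Real.exp_add]; ring_nf
      _ = _ := by field_simp
  have hlimL : Tendsto (fun ε : ℝ => ∑' k : ℤ, bandKernel r (a - k) * G ε ((k - a : ℝ) : ℂ))
      (𝓝[>] 0) (𝓝 (∑' k : ℤ, bandKernel r (a - k) * F ((k - a : ℝ) : ℂ))) := by
    refine tendsto_tsum_of_dominated_convergence (bound := fun k => ‖bandKernel r (a - k)‖ * (M * C))
      (hsum.norm.mul_right _) (fun k => ?_) (Eventually.of_forall fun ε k => ?_)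
    · rw [← hG0]
      apply tendsto_nhdsWithin_of_tendsto_nhds
      refine Continuous.tendsto ?_ 0
      simp only [G]
      fun_prop
    · rw [norm_mul]
      gcongr
      simp only [G, norm_mul, norm_pow]
      rw [← Complex.ofReal_mul, ← Complex.ofReal_mul]
      gcongr
      · exact hFM _
      · have := hC ((Real.pi * ε * (k - a) : ℝ) : ℂ)
        rw [Complex.ofReal_im, abs_zero, mul_zero, Real.exp_zero, mul_one] at this
        refine le_trans ?_ this
        refine le_mul_of_one_le_left (by positivity) ?_
        nlinarith [sq_nonneg ‖((Real.pi * ε * (k - a) : ℝ) : ℂ)‖]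
  have hlimR : Tendsto (fun ε : ℝ => iteratedDeriv r (fun t : ℝ => G ε t) 0)
      (𝓝[>] 0) (𝓝 (iteratedDeriv r (fun t : ℝ => F t) 0)) := by
    -- By the Leibniz and chain rules the derivative at `0` is a polynomial in `ε`, hence continuous
    -- there.
    have hP : ∀ ε : ℝ, iteratedDeriv r (fun t : ℝ => G ε t) 0 =
        ∑ i ∈ Finset.range (r + 1), (r.choose i : ℂ) *
          ((1 - 2 * ε) ^ i • iteratedDeriv i (fun t : ℝ => F t) 0) *
          ((Real.pi * ε) ^ (r - i) • iteratedDeriv (r - i) (fun t : ℝ => entireSinc t ^ 2) 0) := by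
      intro ε
      have c1 : ∀ n : WithTop ℕ∞, ContDiff ℝ n (fun t : ℝ => F t) := fun n =>
        contDiff_real_restriction hdF
      have c2 : ∀ n : WithTop ℕ∞, ContDiff ℝ n (fun t : ℝ => entireSinc t ^ 2) := fun n =>
        contDiff_real_restriction (hs.pow 2)
      have e1 : (fun t : ℝ => G ε t) = (fun t : ℝ => (fun t : ℝ => F t) ((1 - 2 * ε) • t)) *
          (fun t : ℝ => (fun t : ℝ => entireSinc t ^ 2) ((Real.pi * ε) • t)) := by
        ext t
        simp [G]
      rw [e1, iteratedDeriv_mul]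
      · refine Finset.sum_congr rfl fun i _ => ?_
        have d1 := congrFun (iteratedDeriv_comp_const_smul (c1 i) (1 - 2 * ε)) 0
        have d2 := congrFun (iteratedDeriv_comp_const_smul (c2 (r - i : ℕ)) (Real.pi * ε)) 0
        rw [mul_zero] at d1 d2
        exact congrArg₂ (fun x y => (r.choose i : ℂ) * x * y) d1 d2
      · exact ((c1 _).comp (contDiff_const_smul _)).contDiffAt
      · exact ((c2 _).comp (contDiff_const_smul _)).contDiffAt
    have e0 : (fun t : ℝ => F t) = fun t : ℝ => G 0 t := funext fun t => (hG0 t).symm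
    rw [show iteratedDeriv r (fun t : ℝ => F t) 0 = iteratedDeriv r (fun t : ℝ => G 0 t) 0 by
      rw [← e0]]
    simp_rw [hP]
    apply tendsto_nhdsWithin_of_tendsto_nhds
    refine Continuous.tendsto ?_ 0
    fun_prop
  have heq : (fun ε : ℝ => ∑' k : ℤ, bandKernel r (a - k) * G ε ((k - a : ℝ) : ℂ)) =ᶠ[𝓝[>] 0]
      fun ε : ℝ => iteratedDeriv r (fun t : ℝ => G ε t) 0 := by
    filter_upwards [Ioo_mem_nhdsGT (show (0 : ℝ) < 1 / 2 by norm_num)] with ε hε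
    exact (hformula ε hε).tsum_eq
  rw [← tendsto_nhds_unique (hlimL.congr' heq) hlimR]
  refine Summable.hasSum (Summable.of_norm ?_)
  refine Summable.of_nonneg_of_le (fun _ => norm_nonneg _) (fun k => ?_) (hsum.norm.mul_right M)
  rw [norm_mul]
  gcongr
  exact hFM _

/-! ### The sharp constant for the first derivative. -/

theorem bandKernel_one_half (k : ℤ) :
    bandKernel 1 (1 / 2 - k) =
      (((-1 : ℝ) ^ (k + 1) * (Real.pi * ((k : ℝ) - 1 / 2) ^ 2)⁻¹ : ℝ) : ℂ) := by
  have hx : (1 / 2 - k : ℝ) ≠ 0 := by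
    intro h
    have : ((2 * k : ℤ) : ℝ) = ((1 : ℤ) : ℝ) := by push_cast; linarith
    have := Int.cast_injective this
    omega
  rw [← iteratedDeriv_nsinc, iteratedDeriv_one]
  congr 1
  have heq : nsinc =ᶠ[𝓝 (1 / 2 - k : ℝ)] fun x => Real.sin (Real.pi * x) / (Real.pi * x) := by
    filter_upwards [isOpen_ne.mem_nhds hx] with x hx
    rw [nsinc, Real.sinc_of_ne_zero (mul_ne_zero Real.pi_ne_zero hx)]
  have h1 : HasDerivAt (fun x : ℝ => Real.pi * x) Real.pi (1 / 2 - k : ℝ) := by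
    simpa using (hasDerivAt_id (1 / 2 - k : ℝ)).const_mul Real.pi
  have h2 := h1.sin.div h1 (mul_ne_zero Real.pi_ne_zero hx)
  rw [heq.deriv_eq]
  refine h2.deriv.trans ?_
  have hc : Real.cos (Real.pi * (1 / 2 - k)) = 0 := by
    rw [mul_sub, mul_one_div, Real.cos_pi_div_two_sub, mul_comm, Real.sin_int_mul_pi]
  have hs : Real.sin (Real.pi * (1 / 2 - k)) = (-1) ^ k := by
    rw [mul_sub, mul_one_div, Real.sin_pi_div_two_sub, mul_comm, Real.cos_int_mul_pi]
  rw [hc, hs, zpow_add_one₀ (by norm_num : (-1 : ℝ) ≠ 0)]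
  have : (k - 1 / 2 : ℝ) ≠ 0 := fun h => hx (by linarith)
  have hp := Real.pi_ne_zero
  rw [show (1 / 2 - k : ℝ) = -(k - 1 / 2) by ring]
  field_simp
  ring

/-- Evaluate the series of the multiplier at the endpoint `ξ = 1 / 2`: the exponentials undo the
alternating signs, every term is `i` times its modulus, and the sum is `πi`. -/
theorem tsum_norm_bandKernel_one_half : ∑' k : ℤ, ‖bandKernel 1 (1 / 2 - k)‖ = Real.pi := by
  have h := (bandKernel_series (r := 1) (a := 1 / 2) (Or.inr ⟨rfl, odd_one⟩)).2 (1 / 2)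
    ⟨by norm_num, le_rfl⟩
  have hterm : ∀ k : ℤ, bandKernel 1 (1 / 2 - k) *
      Complex.exp (2 * Real.pi * Complex.I * ((k - ((1 / 2 : ℝ) : ℂ)) * ((1 / 2 : ℝ) : ℂ))) =
      ((‖bandKernel 1 (1 / 2 - k)‖ : ℝ) : ℂ) * Complex.I := by
    intro k
    rw [bandKernel_one_half, Complex.norm_real, norm_mul, norm_zpow, norm_neg, norm_one, one_zpow,
      one_mul, Real.norm_of_nonneg (inv_nonneg.2 (mul_nonneg Real.pi_pos.le (sq_nonneg _)))]
    have e : (2 * Real.pi * Complex.I * ((k - ((1 / 2 : ℝ) : ℂ)) * ((1 / 2 : ℝ) : ℂ)) : ℂ) =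
        k * (Real.pi * Complex.I) - Real.pi / 2 * Complex.I := by
      push_cast; ring
    rw [e, Complex.exp_sub, Complex.exp_int_mul, Complex.exp_pi_mul_I,
      Complex.exp_pi_div_two_mul_I, Complex.div_I]
    have h2 : ((-1 : ℂ) ^ k) * (-1) ^ k = 1 := by
      rw [← mul_zpow]; norm_num
    push_cast
    rw [zpow_add_one₀ (by norm_num : (-1 : ℂ) ≠ 0)]
    linear_combination ((Real.pi * (k - 1 / 2) ^ 2 : ℂ)⁻¹ * Complex.I) * h2
  simp_rw [hterm] at h
  have h' := h.tsum_eq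
  rw [tsum_mul_right] at h'
  have h3 : ((∑' k : ℤ, ‖bandKernel 1 (1 / 2 - k)‖ : ℝ) : ℂ) * Complex.I = Real.pi * Complex.I := by
    rw [Complex.ofReal_tsum, h']
    push_cast
    ring
  exact_mod_cast mul_right_cancel₀ Complex.I_ne_zero h3

/-! ### The generator and the first-order Boas operator. -/

section Group

variable {E : Type*} [NormedAddCommGroup E] [NormedSpace ℂ E] {D : E →ₗ.[ℂ] E} {T : ℝ → E →L[ℂ] E}

theorem IsGenerator.hasDerivAt_zero_iff (hT : IsIsometryGroup T) (hD : IsGenerator D T) {x y : E} :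
    (x ∈ D.domain ∧ applyOrZero D x = y) ↔ HasDerivAt (fun t : ℝ => T t x) y 0 := by
  rw [hasDerivAt_iff_tendsto_slope_zero]
  have h1 : (fun t : ℝ => t⁻¹ • (T (0 + t) x - T 0 x)) =
      fun t : ℝ => (t : ℂ)⁻¹ • (T t x - x) := by
    ext t
    rw [zero_add, hT.map_zero, ← Complex.ofReal_inv, Complex.coe_smul]
    rfl
  rw [h1, ← hD x y]
  constructor
  · rintro ⟨h, hy⟩
    refine ⟨h, ?_⟩
    rwa [applyOrZero, dif_pos h] at hy
  · rintro ⟨h, hy⟩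
    refine ⟨h, ?_⟩
    rwa [applyOrZero, dif_pos h]

theorem IsGenerator.hasDerivAt (hT : IsIsometryGroup T) (hD : IsGenerator D T) {x : E}
    (hx : x ∈ D.domain) (t : ℝ) :
    HasDerivAt (fun s : ℝ => T s x) (T t (applyOrZero D x)) t := by
  have h0 := (hD.hasDerivAt_zero_iff hT).1 ⟨hx, rfl⟩
  have h1 : HasDerivAt (fun s : ℝ => T (s - t) x) (applyOrZero D x) t := by
    have h0' : HasDerivAt (fun s : ℝ => T s x) (applyOrZero D x) (t - t) := by rwa [sub_self]
    exact h0'.comp_sub_const t t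
  have h2 := ((T t).restrictScalars ℝ).hasFDerivAt.comp_hasDerivAt t h1
  refine HasDerivAt.congr_of_eventuallyEq h2 (Eventually.of_forall fun s => ?_)
  have := hT.map_add t (s - t)
  rw [add_sub_cancel] at this
  exact (congrArg (fun S : E →L[ℂ] E => S x) this)

theorem mem_smoothDomain_iff {f : E} :
    f ∈ smoothDomain D ↔ ∀ k, powApply D k f ∈ D.domain := by
  simp only [smoothDomain, Set.mem_iInter, powDomain, Set.mem_ofPred_eq]
  exact ⟨fun h k => h (k + 1) k k.lt_succ_self, fun h _ j _ => h j⟩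

theorem powApply_zero (f : E) : powApply D 0 f = f := rfl

theorem powApply_succ (k : ℕ) (f : E) :
    powApply D (k + 1) f = applyOrZero D (powApply D k f) :=
  Function.iterate_succ_apply' _ _ _

theorem IsGenerator.hasDerivAt_powApply (hT : IsIsometryGroup T) (hD : IsGenerator D T) {f : E}
    (hf : f ∈ smoothDomain D) (k : ℕ) (t : ℝ) :
    HasDerivAt (fun s : ℝ => T s (powApply D k f)) (T t (powApply D (k + 1) f)) t := by
  rw [powApply_succ]
  exact hD.hasDerivAt hT (mem_smoothDomain_iff.1 hf k) t

theorem IsGenerator.apply_commute (hT : IsIsometryGroup T) (hD : IsGenerator D T)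
    {B : E →L[ℂ] E} (hB : ∀ t x, B (T t x) = T t (B x)) {x : E} (hx : x ∈ D.domain) :
    B x ∈ D.domain ∧ applyOrZero D (B x) = B (applyOrZero D x) := by
  rw [hD.hasDerivAt_zero_iff hT]
  have h0 := (hD.hasDerivAt_zero_iff hT).1 ⟨hx, rfl⟩
  have h2 := (B.restrictScalars ℝ).hasFDerivAt.comp_hasDerivAt (0 : ℝ) h0
  simp only [← hB]
  exact h2

/-- An operator commuting with the group preserves the domain of `D` and commutes with `D` there, so
one identity `D f = B f` iterates to `D ^ k f = B ^ k f`. -/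
theorem IsGenerator.mem_bernsteinSet_of_eq_apply (hT : IsIsometryGroup T) (hD : IsGenerator D T)
    {B : E →L[ℂ] E} (hB : ∀ t x, B (T t x) = T t (B x)) {σ : ℝ} (hσ : ‖B‖ ≤ σ) {f : E}
    (hf : f ∈ D.domain) (hDf : applyOrZero D f = B f) : f ∈ bernsteinSet D σ := by
  have hpow : ∀ (k : ℕ) t x, (B ^ k) (T t x) = T t ((B ^ k) x) := by
    intro k
    induction k with
    | zero => intro t x; simp
    | succ k ih => intro t x; rw [pow_succ', mul_apply_eq_comp, ih, hB]; rfl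
  have hk : ∀ k, powApply D k f = (B ^ k) f := by
    intro k
    induction k with
    | zero => simp [powApply_zero]
    | succ k ih =>
      rw [powApply_succ, ih, (hD.apply_commute hT (hpow k) hf).2, hDf, pow_succ]
      rfl
  refine ⟨mem_smoothDomain_iff.2 fun k => ?_, fun k => ?_⟩
  · rw [hk]
    exact (hD.apply_commute hT (hpow k) hf).1
  · rw [hk]
    refine ((B ^ k).le_opNorm f).trans ?_
    gcongr
    calc ‖B ^ k‖ ≤ ‖B‖ ^ k := by
          -- The identity has norm `0` on a trivial space, so `k = 0` needs the inequality `‖1‖ ≤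
          -- 1`.
          rcases Nat.eq_zero_or_pos k with rfl | hk
          · simpa using! ContinuousLinearMap.norm_id_le (𝕜 := ℂ) (E := E)
          · exact norm_pow_le' B hk
      _ ≤ σ ^ k := by gcongr

theorem IsIsometryGroup.norm_apply_le_one (hT : IsIsometryGroup T) (t : ℝ) : ‖T t‖ ≤ 1 :=
  ContinuousLinearMap.opNorm_le_bound _ zero_le_one fun x => by rw [hT.isometry, one_mul]

theorem IsIsometryGroup.apply_comm (hT : IsIsometryGroup T) (s t : ℝ) (x : E) :
    T s (T t x) = T t (T s x) := by
  rw [← ContinuousLinearMap.comp_apply, ← hT.map_add, add_comm, hT.map_add,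
    ContinuousLinearMap.comp_apply]

theorem IsIsometryGroup.apply_add (hT : IsIsometryGroup T) (s t : ℝ) (x : E) :
    T (s + t) x = T s (T t x) := by
  rw [hT.map_add, ContinuousLinearMap.comp_apply]

theorem coeff_odd {m : ℕ} (k : ℤ) :
    (((-1 : ℝ) ^ (k + 1) * coeffA m k : ℝ) : ℂ) = bandKernel (2 * m - 1) (1 / 2 - k) := by
  rw [← iteratedDeriv_nsinc, coeffA, ← mul_assoc, ← mul_zpow]
  norm_num

/-- This shows that the separately prescribed `B_{m,0}` is no exception: it is the general formula
read at `k = 0`. -/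
theorem bandKernel_even_zero (m : ℕ) :
    bandKernel (2 * m) 0 = (((-1) ^ m * (Real.pi ^ (2 * m) / (2 * (m : ℝ) + 1)) : ℝ) : ℂ) := by
  have h : ∀ ξ : ℝ, (2 * Real.pi * Complex.I * (ξ : ℂ)) ^ (2 * m) *
      Complex.exp (2 * Real.pi * Complex.I * (((0 : ℝ) : ℂ) * ξ)) =
      ((((-1) ^ m * (2 * Real.pi) ^ (2 * m)) * ξ ^ (2 * m) : ℝ) : ℂ) := by
    intro ξ
    simp only [Complex.ofReal_zero, zero_mul, mul_zero, Complex.exp_zero, mul_one]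
    push_cast
    rw [mul_pow, mul_pow _ Complex.I, pow_mul Complex.I, Complex.I_sq]
    ring
  unfold bandKernel
  simp_rw [h]
  rw [intervalIntegral.integral_ofReal, intervalIntegral.integral_const_mul, integral_pow]
  congr 1
  rw [(show Odd (2 * m + 1) from ⟨m, rfl⟩).neg_pow]
  push_cast
  have : (2 * (m : ℝ) + 1) ≠ 0 := by positivity
  field_simp
  rw [one_div, inv_pow]
  field_simp
  ring

theorem coeff_even {m : ℕ} (k : ℤ) :
    (((-1 : ℝ) ^ (k + 1) * coeffB m k : ℝ) : ℂ) = bandKernel (2 * m) (0 - k) := by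
  by_cases hk : k = 0
  · subst hk
    rw [Int.cast_zero, sub_zero, bandKernel_even_zero, coeffB, if_pos rfl]
    congr 1
    rw [zero_add, zpow_one, pow_succ]
    ring
  · rw [zero_sub, ← iteratedDeriv_nsinc, coeffB, if_neg hk, ← mul_assoc, ← mul_zpow]
    norm_num

theorem boasOddTerm_eq (σ : ℝ) (m : ℕ) (f : E) (k : ℤ) : boasOddTerm T σ m f k =
    bandKernel (2 * m - 1) (1 / 2 - k) • T (Real.pi / σ * (k - 1 / 2)) f := by
  rw [boasOddTerm, coeff_odd]

theorem boasEvenTerm_eq (σ : ℝ) (m : ℕ) (f : E) (k : ℤ) : boasEvenTerm T σ m f k =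
    bandKernel (2 * m) (0 - k) • T (Real.pi / σ * (k - 0)) f := by
  rw [boasEvenTerm, coeff_even, sub_zero, mul_div_right_comm]

/-- The first-order Boas operator, as a bounded operator on `E`. -/
def boasOperator (T : ℝ → E →L[ℂ] E) (σ : ℝ) : E →L[ℂ] E :=
  ((σ / Real.pi : ℝ) : ℂ) • ∑' k : ℤ, bandKernel 1 (1 / 2 - k) • T (Real.pi / σ * (k - 1 / 2))

theorem norm_boasTerm_le (hT : IsIsometryGroup T) (σ : ℝ) (k : ℤ) :
    ‖bandKernel 1 (1 / 2 - k) • T (Real.pi / σ * (k - 1 / 2))‖ ≤ ‖bandKernel 1 (1 / 2 - k)‖ := by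
  rw [norm_smul]
  exact mul_le_of_le_one_right (norm_nonneg _) (hT.norm_apply_le_one _)

theorem summable_bandKernel_one : Summable fun k : ℤ => ‖bandKernel 1 (1 / 2 - k)‖ :=
  (bandKernel_series (r := 1) (a := 1 / 2) (Or.inr ⟨rfl, odd_one⟩)).1.norm

theorem norm_boasOperator_le (hT : IsIsometryGroup T) {σ : ℝ} (hσ : 0 < σ) :
    ‖boasOperator T σ‖ ≤ σ := by
  rw [boasOperator, norm_smul, Complex.norm_real,
    Real.norm_of_nonneg (div_nonneg hσ.le Real.pi_pos.le)]
  have := tsum_of_norm_bounded summable_bandKernel_one.hasSum (norm_boasTerm_le hT σ)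
  rw [tsum_norm_bandKernel_one_half] at this
  calc _ ≤ σ / Real.pi * Real.pi := by
        have := Real.pi_pos
        gcongr
    _ = σ := div_mul_cancel₀ _ Real.pi_ne_zero

theorem hasSum_boasOperator [CompleteSpace E] (hT : IsIsometryGroup T) (σ : ℝ) (x : E) :
    HasSum (fun k : ℤ => ((σ / Real.pi : ℝ) : ℂ) •
      bandKernel 1 (1 / 2 - k) • T (Real.pi / σ * (k - 1 / 2)) x) (boasOperator T σ x) := by
  have hs : Summable fun k : ℤ => bandKernel 1 (1 / 2 - k) • T (Real.pi / σ * (k - 1 / 2)) :=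
    Summable.of_norm_bounded summable_bandKernel_one (norm_boasTerm_le hT σ)
  exact ((hs.hasSum).mapL (ContinuousLinearMap.apply ℂ E x)).const_smul _

theorem boasOperator_comm [CompleteSpace E] (hT : IsIsometryGroup T) (σ t : ℝ) (x : E) :
    boasOperator T σ (T t x) = T t (boasOperator T σ x) := by
  have h1 := hasSum_boasOperator hT σ (T t x)
  have h2 := (hasSum_boasOperator hT σ x).mapL (T t)
  simp only [map_smul, hT.apply_comm t] at h2
  exact h1.unique h2

theorem boasOdd_one_eq [CompleteSpace E] (hT : IsIsometryGroup T) (σ : ℝ) (f : E) :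
    boasOdd T σ 1 f = boasOperator T σ f := by
  rw [← (hasSum_boasOperator hT σ f).tsum_eq, tsum_const_smul'', boasOdd, mul_one, pow_one]
  simp_rw [boasOddTerm_eq]

end Group

/-! ### Rescaling and testing functions of exponential type. -/

theorem MemBernstein.comp_affine {X : Type*} [NormedAddCommGroup X] [NormedSpace ℂ X] {σ : ℝ}
    {u : ℝ → X} (hσ : 0 < σ) (hu : MemBernstein σ u) {c : ℝ} (hc : 0 < c) (t : ℝ) :
    MemBernstein (σ * c) fun s => u (t + c * s) := by
  obtain ⟨⟨F, hF, hFu⟩, M, hM⟩ := hu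
  refine ⟨⟨fun z => F (t + c * z), ⟨?_, fun ε hε => ?_⟩, fun s => ?_⟩, M, fun s => hM _⟩
  · exact hF.1.comp ((differentiable_id.const_mul _).const_add _)
  · obtain ⟨C, hC⟩ := hF.2 (ε / c) (by positivity)
    have hC0 : 0 ≤ C := by
      have := (norm_nonneg _).trans (hC 0)
      simpa using this
    refine ⟨C * Real.exp ((σ + ε / c) * |t|), fun z => (hC _).trans ?_⟩
    rw [mul_assoc, ← Real.exp_add]
    gcongr
    have h1 : ‖(t + c * z : ℂ)‖ ≤ |t| + c * ‖z‖ := by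
      refine (norm_add_le _ _).trans ?_
      rw [norm_mul, Complex.norm_real, Complex.norm_real, Real.norm_eq_abs, Real.norm_of_nonneg hc.le]
    calc (σ + ε / c) * ‖(t + c * z : ℂ)‖ ≤ (σ + ε / c) * (|t| + c * ‖z‖) := by gcongr
      _ = _ := by field_simp
  · simp only [← hFu]
    push_cast
    rfl

theorem MemBernstein.clm_comp {X Y : Type*} [NormedAddCommGroup X] [NormedSpace ℂ X]
    [NormedAddCommGroup Y] [NormedSpace ℂ Y] {σ : ℝ} {u : ℝ → X} (hu : MemBernstein σ u)
    (g : X →L[ℂ] Y) : MemBernstein σ fun t => g (u t) := by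
  obtain ⟨⟨F, hF, hFu⟩, M, hM⟩ := hu
  refine ⟨⟨fun z => g (F z), ⟨g.differentiable.comp hF.1, fun ε hε => ?_⟩, fun t =>
    congrArg g (hFu t)⟩, ‖g‖ * M, fun t => (g.le_opNorm _).trans (by gcongr; exact hM t)⟩
  obtain ⟨C, hC⟩ := hF.2 ε hε
  refine ⟨‖g‖ * C, fun z => (g.le_opNorm _).trans ?_⟩
  rw [mul_assoc]
  gcongr
  exact hC z

theorem MemBernstein.differentiable {σ : ℝ} {u : ℝ → ℂ} (hu : MemBernstein σ u) :
    Differentiable ℝ u := by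
  obtain ⟨⟨F, hF, hFu⟩, -⟩ := hu
  obtain rfl : (fun t : ℝ => F t) = u := funext hFu
  exact (contDiff_real_restriction hF.1 (n := 1)).differentiable (by norm_num)

/-! ### From scalar orbits, or the Boas formulas, to Bernstein vectors. -/

section Group

variable {E : Type*} [NormedAddCommGroup E] [NormedSpace ℂ E] {D : E →ₗ.[ℂ] E} {T : ℝ → E →L[ℂ] E}

/-- Sampling applied to `s ↦ g (T (t + πs/σ) f)`, of type `π`: the group law turns the sampled
values into the series of the Boas operator. -/
theorem hasDerivAt_of_memBernstein [CompleteSpace E] (hT : IsIsometryGroup T) {σ : ℝ} (hσ : 0 < σ)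
    {f : E} {g : E →L[ℂ] ℂ} (hg : MemBernstein σ fun t : ℝ => g (T t f)) (t : ℝ) :
    HasDerivAt (fun s : ℝ => g (T s f)) (g (T t (boasOperator T σ f))) t := by
  have hpi := Real.pi_pos
  have hc : 0 < Real.pi / σ := by positivity
  have h1 := hg.comp_affine hσ hc t
  rw [mul_div_cancel₀ _ hσ.ne'] at h1
  have h2 := hasSum_iteratedDeriv_of_memBernstein h1 (r := 1) (a := 1 / 2) (Or.inr ⟨rfl, odd_one⟩)
  have hd := (hg.differentiable t).hasDerivAt
  have h3 : HasDerivAt (fun s : ℝ => g (T (t + Real.pi / σ * s) f))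
      ((Real.pi / σ) • deriv (fun s : ℝ => g (T s f)) t) 0 := by
    have ha : HasDerivAt (fun s : ℝ => t + Real.pi / σ * s) (Real.pi / σ) 0 := by
      simpa using ((hasDerivAt_id (0 : ℝ)).const_mul (Real.pi / σ)).const_add t
    have hd' : HasDerivAt (fun s : ℝ => g (T s f)) (deriv (fun s : ℝ => g (T s f)) t)
        (t + Real.pi / σ * 0) := by
      rw [mul_zero, add_zero]
      exact hd
    exact hd'.scomp (0 : ℝ) ha
  rw [iteratedDeriv_one, h3.deriv] at h2
  have h4 := ((hasSum_boasOperator hT σ f).mapL (T t)).mapL g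
  simp only [map_smul, ← hT.apply_add] at h4
  have h5 := h2.const_smul ((σ / Real.pi : ℝ) : ℂ)
  have h6 := h4.unique h5
  rw [h6, Complex.coe_smul, smul_smul, div_mul_div_cancel₀ hpi.ne', div_self hσ.ne', one_smul]
  exact hd

/-- The candidate derivative has a continuous orbit, so its integral is strongly differentiable.
Functionals identify that integral with `T t f - f`, which upgrades the weak derivative to a norm
derivative and puts `f` in the domain. -/
theorem mem_bernsteinSet_of_forall_dual [CompleteSpace E] (hT : IsIsometryGroup T)
    (hD : IsGenerator D T) {σ : ℝ} (hσ : 0 < σ) {f : E}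
    (h : ∀ g : E →L[ℂ] ℂ, MemBernstein σ fun t : ℝ => g (T t f)) : f ∈ bernsteinSet D σ := by
  set y := boasOperator T σ f with hy
  have hint : ∀ t : ℝ, HasDerivAt (fun t : ℝ => ∫ s in (0 : ℝ)..t, T s y) (T t y) t := fun t =>
    intervalIntegral.integral_hasDerivAt_right
      ((hT.strongly_continuous y).intervalIntegrable _ _)
      (hT.strongly_continuous y).stronglyMeasurable.stronglyMeasurableAtFilter
      (hT.strongly_continuous y).continuousAt
  have heq : ∀ t : ℝ, T t f = f + ∫ s in (0 : ℝ)..t, T s y := by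
    intro t
    rw [← sub_eq_zero]
    refine SeparatingDual.eq_zero_of_forall_dual_eq_zero (R := ℂ) fun g => ?_
    have hder : ∀ s : ℝ, HasDerivAt (fun t : ℝ => g (T t f - (f + ∫ s in (0 : ℝ)..t, T s y)))
        0 s := by
      intro s
      have h1 := hasDerivAt_of_memBernstein hT hσ (h g) s
      have h2 := (g.restrictScalars ℝ).hasFDerivAt.comp_hasDerivAt s ((hint s).const_add f)
      have h3 := h1.sub h2
      rw [← hy] at h3
      simp only [ContinuousLinearMap.coe_restrictScalars', sub_self] at h3
      refine HasDerivAt.congr_of_eventuallyEq h3 (Eventually.of_forall fun t => ?_)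
      exact map_sub g _ _
    have := is_const_of_deriv_eq_zero (fun s => (hder s).differentiableAt)
      (fun s => (hder s).deriv) t 0
    simpa [hT.map_zero] using this
  have hf : f ∈ D.domain ∧ applyOrZero D f = y := by
    rw [hD.hasDerivAt_zero_iff hT]
    have h0 := (hint 0).const_add f
    rw [hT.map_zero] at h0
    exact h0.congr_of_eventuallyEq (Eventually.of_forall heq)
  exact hD.mem_bernsteinSet_of_eq_apply hT (boasOperator_comm hT σ)
    (norm_boasOperator_le hT hσ) hf.1 hf.2

theorem mem_bernsteinSet_of_boasFormulas [CompleteSpace E] (hT : IsIsometryGroup T)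
    (hD : IsGenerator D T) {σ : ℝ} (hσ : 0 < σ) {f : E} (h : BoasFormulas D T σ f) :
    f ∈ bernsteinSet D σ := by
  have h1 := ((h.2 1 le_rfl).1).2
  rw [boasOdd_one_eq hT] at h1
  exact hD.mem_bernsteinSet_of_eq_apply hT (boasOperator_comm hT σ)
    (norm_boasOperator_le hT hσ) (mem_smoothDomain_iff.1 h.1 0) h1

end Group

/-! ### Taylor expansion of orbits and the Boas formulas. -/

theorem norm_sub_taylor_le_of_nonneg {X : Type*} [NormedAddCommGroup X] [NormedSpace ℝ X] (n : ℕ)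
    {h : ℕ → ℝ → X} (hd : ∀ k t, HasDerivAt (h k) (h (k + 1) t) t) {A : ℝ}
    (hA : ∀ t, ‖h n t‖ ≤ A) {t : ℝ} (ht : 0 ≤ t) :
    ‖h 0 t - ∑ k ∈ Finset.range n, (t ^ k / k.factorial) • h k 0‖ ≤
      A * (t ^ n / n.factorial) := by
  induction n generalizing h t with
  | zero => simpa using hA t
  | succ n ih =>
    have hB : ∀ (k : ℕ) (s : ℝ), HasDerivAt (fun s : ℝ => s ^ (k + 1) / ((k + 1).factorial : ℝ))
        (s ^ k / k.factorial) s := by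
      intro k s
      refine ((hasDerivAt_pow (k + 1) s).div_const _).congr_deriv ?_
      rw [Nat.factorial_succ]
      push_cast
      have h1 : (k.factorial : ℝ) ≠ 0 := by positivity
      have h2 : (k + 1 : ℝ) ≠ 0 := by positivity
      field_simp
    have hder : ∀ s, HasDerivAt
        (fun s => h 0 s - ∑ k ∈ Finset.range (n + 1), (s ^ k / (k.factorial : ℝ)) • h k 0)
        (h 1 s - ∑ k ∈ Finset.range n, (s ^ k / (k.factorial : ℝ)) • h (k + 1) 0) s := by
      intro s
      refine (hd 0 s).sub ?_
      simp_rw [Finset.sum_range_succ']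
      simp only [pow_zero]
      refine HasDerivAt.add_const _ ?_
      exact HasDerivAt.fun_sum fun k _ => (hB k s).smul_const _
    refine image_norm_le_of_norm_deriv_right_le_deriv_boundary (a := 0) (b := t)
      (B := fun s => A * (s ^ (n + 1) / ((n + 1).factorial : ℝ)))
      (fun s _ => (hder s).continuousAt.continuousWithinAt) (fun s _ => (hder s).hasDerivWithinAt)
      ?_ (fun s => (hB n s).const_mul A) (fun s hs => ?_) ⟨ht, le_rfl⟩
    · rw [Finset.sum_range_succ']
      simp
    · exact ih (h := fun k => h (k + 1)) (fun k s => hd (k + 1) s) hA hs.1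

theorem norm_sub_taylor_le {X : Type*} [NormedAddCommGroup X] [NormedSpace ℝ X] (n : ℕ)
    {h : ℕ → ℝ → X} (hd : ∀ k t, HasDerivAt (h k) (h (k + 1) t) t) {A : ℝ}
    (hA : ∀ t, ‖h n t‖ ≤ A) (t : ℝ) :
    ‖h 0 t - ∑ k ∈ Finset.range n, (t ^ k / k.factorial) • h k 0‖ ≤
      A * (|t| ^ n / n.factorial) := by
  rcases le_total 0 t with ht | ht
  · rw [abs_of_nonneg ht]
    exact norm_sub_taylor_le_of_nonneg n hd hA ht
  · have := norm_sub_taylor_le_of_nonneg n (h := fun k s => ((-1 : ℝ) ^ k) • h k (-s))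
      (fun k s => by
        have h1 := ((hd k (-s)).scomp s (hasDerivAt_neg s)).const_smul ((-1 : ℝ) ^ k)
        refine h1.congr_deriv ?_
        rw [smul_smul, pow_succ]) (A := A)
      (fun s => by
        rw [norm_smul, norm_pow, norm_neg, norm_one, one_pow, one_mul]
        exact hA _) (neg_nonneg.2 ht)
    rw [abs_of_nonpos ht]
    refine le_of_eq_of_le ?_ this
    simp only [pow_zero, one_smul, neg_neg, neg_zero, smul_smul]
    congr 2
    refine Finset.sum_congr rfl fun k _ => ?_
    congr 1
    rw [div_mul_eq_mul_div, ← mul_pow]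
    simp

section Group

variable {E : Type*} [NormedAddCommGroup E] [NormedSpace ℂ E] {D : E →ₗ.[ℂ] E} {T : ℝ → E →L[ℂ] E}

theorem memBernstein_of_norm_powApply_le [CompleteSpace E] (hT : IsIsometryGroup T)
    (hD : IsGenerator D T) {τ C : ℝ} {f : E} (hf : f ∈ smoothDomain D)
    (hC : ∀ k, ‖powApply D k f‖ ≤ C * τ ^ k) : MemBernstein τ fun t : ℝ => T t f := by
  have hC0 : 0 ≤ C := by simpa using (norm_nonneg _).trans (hC 0)
  have hterm : ∀ (R : ℝ) (z : ℂ), ‖z‖ ≤ R → ∀ k : ℕ,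
      ‖(z ^ k / (k.factorial : ℂ)) • powApply D k f‖ ≤ C * ((τ * R) ^ k / k.factorial) := by
    intro R z hz k
    rw [norm_smul, norm_div, norm_pow, Complex.norm_natCast]
    calc _ ≤ R ^ k / k.factorial * (C * τ ^ k) := by
          have hR : 0 ≤ R := (norm_nonneg z).trans hz
          gcongr
          exact hC k
      _ = _ := by rw [mul_pow]; ring
  have hsum : ∀ R : ℝ, Summable fun k : ℕ => C * ((τ * R) ^ k / k.factorial) := fun R =>
    (Real.summable_pow_div_factorial _).mul_left C
  refine ⟨⟨fun z => ∑' k : ℕ, (z ^ k / (k.factorial : ℂ)) • powApply D k f, ⟨?_, ?_⟩, ?_⟩, ‖f‖,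
    fun t => (hT.isometry t f).le⟩
  · intro z
    have := Complex.differentiableOn_tsum_of_summable_norm (hsum (‖z‖ + 1))
      (F := fun (k : ℕ) (z : ℂ) => (z ^ k / (k.factorial : ℂ)) • powApply D k f)
      (U := Metric.ball 0 (‖z‖ + 1))
      (fun k => by fun_prop) Metric.isOpen_ball
      (fun k w hw => hterm _ w (by simpa using (Metric.mem_ball.1 hw).le) k)
    exact this.differentiableAt (Metric.isOpen_ball.mem_nhds (by simp))
  · intro ε hε
    refine ⟨C, fun z => ?_⟩
    have h1 := tsum_of_norm_bounded (hsum ‖z‖).hasSum (hterm ‖z‖ z le_rfl)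
    refine h1.trans ?_
    rw [tsum_mul_left]
    have h2 : ∑' k : ℕ, (τ * ‖z‖) ^ k / (k.factorial : ℝ) = Real.exp (τ * ‖z‖) := by
      rw [Real.exp_eq_exp_ℝ, NormedSpace.exp_eq_tsum_div]
    rw [h2]
    gcongr
    linarith
  · intro t
    have hs : Summable fun k : ℕ => ((t : ℂ) ^ k / (k.factorial : ℂ)) • powApply D k f :=
      Summable.of_norm_bounded (hsum ‖(t : ℂ)‖) (hterm _ _ le_rfl)
    refine tendsto_nhds_unique hs.hasSum.tendsto_sum_nat ?_
    rw [tendsto_iff_norm_sub_tendsto_zero]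
    -- The Taylor remainder is at most the general term of a convergent exponential series.
    refine squeeze_zero (fun _ => norm_nonneg _) (fun n => ?_)
      ((hsum |t|).tendsto_atTop_zero)
    have := norm_sub_taylor_le n (fun k s => hD.hasDerivAt_powApply hT hf k s) (A := C * τ ^ n)
      (fun s => by rw [hT.isometry]; exact hC n) t
    rw [norm_sub_rev]
    refine le_of_eq_of_le ?_ (this.trans_eq ?_)
    · rw [powApply_zero]
      congr 2
      refine Finset.sum_congr rfl fun k _ => ?_
      rw [hT.map_zero, ← Complex.coe_smul]
      push_cast
      rfl
    · rw [mul_pow]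
      ring

theorem iteratedDeriv_dual_apply (hT : IsIsometryGroup T) (hD : IsGenerator D T) {f : E}
    (hf : f ∈ smoothDomain D) (g : E →L[ℂ] ℂ) (c : ℝ) (r : ℕ) :
    iteratedDeriv r (fun s : ℝ => g (T (c * s) f)) =
      fun s => ((c ^ r : ℝ) : ℂ) • g (T (c * s) (powApply D r f)) := by
  induction r with
  | zero => simp [powApply_zero]
  | succ r ih =>
    rw [iteratedDeriv_succ, ih]
    ext s
    have h1 := (g.restrictScalars ℝ).hasFDerivAt.comp_hasDerivAt (c * s)
      (hD.hasDerivAt_powApply hT hf r (c * s))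
    have ha : HasDerivAt (fun s : ℝ => c * s) c s := by
      simpa using (hasDerivAt_id s).const_mul c
    have h2 := (HasDerivAt.scomp s (h := fun s : ℝ => c * s) h1 ha).const_smul ((c ^ r : ℝ) : ℂ)
    refine h2.deriv.trans ?_
    rw [pow_succ]
    simp [mul_assoc]

/-- The kernel values are absolutely summable and the orbit has constant norm, so the series
converges in norm; its sum is then identified by scalar sampling. -/
theorem hasSum_powApply [CompleteSpace E] (hT : IsIsometryGroup T) (hD : IsGenerator D T)
    {σ : ℝ} (hσ : 0 < σ) {f : E} (hf : f ∈ bernsteinSet D σ) {r : ℕ} {a : ℝ}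
    (h : IsNodeShift r a) :
    HasSum (fun k : ℤ => bandKernel r (a - k) • T (Real.pi / σ * (k - a)) f)
      ((((Real.pi / σ) ^ r : ℝ) : ℂ) • powApply D r f) := by
  have hs : Summable fun k : ℤ => bandKernel r (a - k) • T (Real.pi / σ * (k - a)) f := by
    refine Summable.of_norm_bounded ((bandKernel_series h).1.norm.mul_right ‖f‖) fun k => ?_
    rw [norm_smul, hT.isometry]
  have hmem := memBernstein_of_norm_powApply_le hT hD hf.1 (C := ‖f‖)
    (fun k => by rw [mul_comm]; exact hf.2 k)
  convert hs.hasSum using 1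
  rw [← sub_eq_zero]
  refine SeparatingDual.eq_zero_of_forall_dual_eq_zero (R := ℂ) fun g => ?_
  rw [map_sub, sub_eq_zero]
  have hpi := Real.pi_pos
  have h1 := (hmem.clm_comp g).comp_affine hσ (c := Real.pi / σ) (by positivity) 0
  rw [mul_div_cancel₀ _ hσ.ne'] at h1
  simp only [zero_add] at h1
  have h2 := hasSum_iteratedDeriv_of_memBernstein h1 h
  rw [iteratedDeriv_dual_apply hT hD hf.1] at h2
  have h3 := hs.hasSum.mapL g
  simp only [map_smul] at h3
  have h4 := h2.unique h3
  rw [← h4]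
  simp only [mul_zero, hT.map_zero, map_smul]
  rfl

theorem boasFormulas_of_mem_bernsteinSet [CompleteSpace E] (hT : IsIsometryGroup T)
    (hD : IsGenerator D T) {σ : ℝ} (hσ : 0 < σ) {f : E} (hf : f ∈ bernsteinSet D σ) :
    BoasFormulas D T σ f := by
  have hcancel : ∀ r : ℕ, (((σ / Real.pi) ^ r : ℝ) : ℂ) • (((Real.pi / σ) ^ r : ℝ) : ℂ) •
      powApply D r f = powApply D r f := by
    intro r
    rw [smul_smul, ← Complex.ofReal_mul, ← mul_pow, div_mul_div_cancel₀ Real.pi_ne_zero,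
      div_self hσ.ne', one_pow, Complex.ofReal_one, one_smul]
  refine ⟨hf.1, fun m hm => ⟨?_, ?_⟩⟩
  · have h := hasSum_powApply hT hD hσ hf (r := 2 * m - 1) (a := 1 / 2)
      (Or.inr ⟨rfl, m - 1, by omega⟩)
    simp_rw [← boasOddTerm_eq] at h
    refine ⟨h.summable, ?_⟩
    rw [boasOdd, h.tsum_eq, hcancel]
  · have h := hasSum_powApply hT hD hσ hf (r := 2 * m) (a := 0) (Or.inl ⟨rfl, even_two_mul m⟩)
    simp_rw [← boasEvenTerm_eq] at h
    refine ⟨h.summable, ?_⟩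
    rw [boasEven, h.tsum_eq, hcancel]

/-- Self-improvement of the constant from `C` to `‖f‖`: the type of the orbit depends only on `τ`,
and the criterion through functionals does not see `C`. -/
theorem mem_bernsteinSet_of_norm_powApply_le [CompleteSpace E] (hT : IsIsometryGroup T)
    (hD : IsGenerator D T) {τ C : ℝ} (hτ : 0 < τ) {f : E} (hf : f ∈ smoothDomain D)
    (hC : ∀ k, ‖powApply D k f‖ ≤ C * τ ^ k) : f ∈ bernsteinSet D τ :=
  mem_bernsteinSet_of_forall_dual hT hD hτ fun g =>
    (memBernstein_of_norm_powApply_le hT hD hf hC).clm_comp g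

end Group

/-! ### A Kolmogorov type inequality through resolvent estimates. -/

/-- The hypothesis degenerates on the imaginary axis. Multiplying by `1 + w² / ρ²`, of modulus `2
|Re w| / ρ` on the circle, cancels this loss, at the price of extracting two coefficients together.
-/
theorem norm_laurent_coeff_le {X : Type*} [NormedAddCommGroup X] [NormedSpace ℂ X]
    [CompleteSpace X] {x : ℕ → X} {n k : ℕ} (hk : k + 2 < n) {ρ A : ℝ} (hρ : 0 < ρ)
    (hA : ∀ w : ℂ, ‖w‖ = ρ → |w.re| * ‖∑ j ∈ Finset.range n, (w ^ (j + 1))⁻¹ • x j‖ ≤ A) :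
    ‖x k + ((ρ ^ 2)⁻¹ : ℂ) • x (k + 2)‖ ≤ 2 * ρ ^ k * A := by
  set c : ℂ := ((ρ ^ 2)⁻¹ : ℂ) with hc
  have hint : ∀ m : ℤ, (∮ w in C(0, ρ), (w - 0) ^ m) = if m = -1 then 2 * Real.pi * Complex.I
      else 0 := by
    intro m
    split_ifs with hm
    · subst hm
      simp only [zpow_neg_one]
      exact circleIntegral.integral_sub_center_inv 0 hρ.ne'
    · exact circleIntegral.integral_sub_zpow_of_ne hm 0 0 ρ
  have hci : ∀ m : ℤ, CircleIntegrable (fun w : ℂ => (w - 0) ^ m) 0 ρ := by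
    intro m
    rw [circleIntegrable_sub_zpow_iff]
    right; right
    simpa using (abs_pos.2 hρ.ne').ne
  have hci' : ∀ m : ℤ, CircleIntegrable (fun w : ℂ => c * (w - 0) ^ m) 0 ρ :=
    fun m => (hci m).const_smul (a := c)
  have hval : (∮ w in C(0, ρ), ∑ j ∈ Finset.range n,
      ((w - 0) ^ ((k : ℤ) - j - 1) + c * (w - 0) ^ ((k : ℤ) - j + 1)) • x j) =
      (2 * Real.pi * Complex.I : ℂ) • (x k + c • x (k + 2)) := by
    rw [circleIntegral.integral_fun_sum]
    · have hj : ∀ j : ℕ, (∮ w in C(0, ρ),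
          ((w - 0) ^ ((k : ℤ) - j - 1) + c * (w - 0) ^ ((k : ℤ) - j + 1)) • x j) =
          (if j = k then (2 * Real.pi * Complex.I : ℂ) • x k else 0) +
          (if j = k + 2 then (2 * Real.pi * Complex.I : ℂ) • (c • x (k + 2)) else 0) := by
        intro j
        rw [circleIntegral.integral_smul_const,
          circleIntegral.integral_add (hci _) (hci' _),
          circleIntegral.integral_const_mul, hint, hint, add_smul]
        congr 1
        · by_cases h : j = k
          · subst h; simp
          · rw [if_neg h, if_neg (by omega), zero_smul]
        · by_cases h : j = k + 2
          · subst h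
            rw [if_pos rfl, if_pos (by push_cast; ring), smul_smul, mul_comm]
          · rw [if_neg h, if_neg (by omega), mul_zero, zero_smul]
      simp_rw [hj]
      rw [Finset.sum_add_distrib, Finset.sum_ite_eq' , Finset.sum_ite_eq', if_pos, if_pos, smul_add]
      · simpa using hk
      · simp; omega
    · intro j _
      refine ContinuousOn.circleIntegrable hρ.le ?_
      have hne : ∀ w ∈ Metric.sphere (0 : ℂ) ρ, w - 0 ≠ 0 := by
        intro w hw
        rw [sub_zero]
        exact Metric.ne_of_mem_sphere hw hρ.ne'
      refine ContinuousOn.smul (ContinuousOn.add ?_ (continuousOn_const.mul ?_)) continuousOn_const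
      · exact ContinuousOn.zpow₀ (by fun_prop) _ fun w hw => Or.inl (hne w hw)
      · exact ContinuousOn.zpow₀ (by fun_prop) _ fun w hw => Or.inl (hne w hw)
  have hbound : ∀ w ∈ Metric.sphere (0 : ℂ) ρ, ‖∑ j ∈ Finset.range n,
      ((w - 0) ^ ((k : ℤ) - j - 1) + c * (w - 0) ^ ((k : ℤ) - j + 1)) • x j‖ ≤
      2 * ρ ^ k * A / ρ := by
    intro w hw
    have hw' : ‖w‖ = ρ := by simpa using hw
    have hw0 : w ≠ 0 := by rintro rfl; rw [norm_zero] at hw'; exact hρ.ne hw'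
    have e : ∑ j ∈ Finset.range n,
        ((w - 0) ^ ((k : ℤ) - j - 1) + c * (w - 0) ^ ((k : ℤ) - j + 1)) • x j =
        ((1 + c * w ^ 2) * w ^ k) • ∑ j ∈ Finset.range n, (w ^ (j + 1))⁻¹ • x j := by
      rw [Finset.smul_sum]
      refine Finset.sum_congr rfl fun j _ => ?_
      rw [smul_smul, sub_zero]
      congr 1
      rw [show (k : ℤ) - j - 1 = (k : ℤ) - ((j + 1 : ℕ) : ℤ) by push_cast; ring,
        show (k : ℤ) - j + 1 = ((k + 2 : ℕ) : ℤ) - ((j + 1 : ℕ) : ℤ) by push_cast; ring,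
        zpow_sub₀ hw0, zpow_sub₀ hw0, zpow_natCast, zpow_natCast, zpow_natCast]
      ring
    have hfac : ‖1 + c * w ^ 2‖ = 2 * |w.re| / ρ := by
      have hconj : w * (starRingEnd ℂ) w = (ρ : ℂ) ^ 2 := by
        rw [Complex.mul_conj, Complex.normSq_eq_norm_sq, hw']
        push_cast
        rfl
      have hρ' : (ρ : ℂ) ^ 2 ≠ 0 := by
        have : (ρ : ℂ) ≠ 0 := by exact_mod_cast hρ.ne'
        positivity
      have : 1 + c * w ^ 2 = c * (w * ((2 * w.re : ℝ) : ℂ)) := by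
        rw [← Complex.add_conj, mul_add, hconj, hc, mul_add, inv_mul_cancel₀ hρ']
        ring
      rw [this, norm_mul, norm_mul, hw', Complex.norm_real, Real.norm_eq_abs, abs_mul, abs_two, hc,
        norm_inv, norm_pow, Complex.norm_real, Real.norm_of_nonneg hρ.le]
      field_simp
    rw [e, norm_smul, norm_mul, hfac, norm_pow, hw']
    calc _ = 2 * ρ ^ k / ρ * (|w.re| * ‖∑ j ∈ Finset.range n, (w ^ (j + 1))⁻¹ • x j‖) := by ring
      _ ≤ 2 * ρ ^ k / ρ * A := by gcongr; exact hA w hw'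
      _ = _ := by ring
  have h := circleIntegral.norm_two_pi_i_inv_smul_integral_le_of_norm_le_const hρ.le hbound
  rw [hval, smul_smul, inv_mul_cancel₀ Complex.two_pi_I_ne_zero, one_smul,
    mul_div_cancel₀ _ hρ.ne'] at h
  exact h

section Group

variable {E : Type*} [NormedAddCommGroup E] [NormedSpace ℂ E] {D : E →ₗ.[ℂ] E} {T : ℝ → E →L[ℂ] E}

/-- Both `D` and `-D` are dissipative: for `t` of the same sign as `Re w`, compare `‖(1 + t w) x‖`
with `‖T t x‖ = ‖x‖`, divide by `|t|` and take the one-sided limit. -/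
theorem IsGenerator.abs_re_mul_norm_le (hT : IsIsometryGroup T) (hD : IsGenerator D T) {x : E}
    (hx : x ∈ D.domain) (w : ℂ) : |w.re| * ‖x‖ ≤ ‖w • x - applyOrZero D x‖ := by
  have h0 := (hasDerivAt_iff_tendsto_slope_zero.1 ((hD.hasDerivAt_zero_iff hT).1 ⟨hx, rfl⟩))
  have h1 : Tendsto (fun t : ℝ => ‖w • x - t⁻¹ • (T (0 + t) x - T 0 x)‖) (𝓝[≠] 0)
      (𝓝 ‖w • x - applyOrZero D x‖) := (tendsto_const_nhds.sub h0).norm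
  have key : ∀ t : ℝ, t ≠ 0 → 0 ≤ t * w.re →
      |w.re| * ‖x‖ ≤ ‖w • x - t⁻¹ • (T (0 + t) x - T 0 x)‖ := by
    intro t ht htw
    have e : (1 + t * w : ℂ) • x - T t x = t • (w • x - t⁻¹ • (T (0 + t) x - T 0 x)) := by
      rw [smul_sub, smul_smul, mul_inv_cancel₀ ht, one_smul, zero_add, hT.map_zero, add_smul,
        one_smul, mul_smul, Complex.coe_smul]
      simp only [ContinuousLinearMap.id_apply]
      abel
    have h2 : |t| * (|w.re| * ‖x‖) ≤ |t| * ‖w • x - t⁻¹ • (T (0 + t) x - T 0 x)‖ := by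
      rw [← Real.norm_eq_abs t, ← norm_smul, ← e]
      refine le_trans ?_ (norm_sub_norm_le _ _)
      rw [norm_smul, hT.isometry, Real.norm_eq_abs, ← mul_assoc, ← abs_mul, abs_of_nonneg htw]
      have h3 : 1 + t * w.re ≤ ‖(1 + t * w : ℂ)‖ := by
        have := Complex.re_le_norm (1 + t * w : ℂ)
        simpa using this
      nlinarith [norm_nonneg x]
    exact le_of_mul_le_mul_left h2 (abs_pos.2 ht)
  rcases le_total 0 w.re with hw | hw
  · have h2 : Tendsto (fun t : ℝ => ‖w • x - t⁻¹ • (T (0 + t) x - T 0 x)‖) (𝓝[>] 0)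
        (𝓝 ‖w • x - applyOrZero D x‖) :=
      h1.mono_left (nhdsWithin_mono _ fun t (ht : 0 < t) => ht.ne')
    refine ge_of_tendsto h2 (eventually_nhdsWithin_of_forall fun t ht => ?_)
    exact key t (ne_of_gt ht) (mul_nonneg (le_of_lt ht) hw)
  · have h2 : Tendsto (fun t : ℝ => ‖w • x - t⁻¹ • (T (0 + t) x - T 0 x)‖) (𝓝[<] 0)
        (𝓝 ‖w • x - applyOrZero D x‖) :=
      h1.mono_left (nhdsWithin_mono _ fun t (ht : t < 0) => ht.ne)
    refine ge_of_tendsto h2 (eventually_nhdsWithin_of_forall fun t ht => ?_)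
    exact key t (ne_of_lt ht) (mul_nonneg_of_nonpos_of_nonpos (le_of_lt ht) hw)

theorem applyOrZero_add_smul {x y : E} (hx : x ∈ D.domain) (hy : y ∈ D.domain) (c : ℂ) :
    applyOrZero D (x + c • y) = applyOrZero D x + c • applyOrZero D y := by
  have hxy : x + c • y ∈ D.domain := D.domain.add_mem hx (D.domain.smul_mem c hy)
  rw [applyOrZero, applyOrZero, applyOrZero, dif_pos hx, dif_pos hy, dif_pos hxy, ← D.map_smul,
    ← D.map_add]
  rfl

theorem applyOrZero_zero : applyOrZero D (0 : E) = 0 := by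
  rw [applyOrZero, dif_pos D.domain.zero_mem]
  exact D.map_zero

/-- Truncating the Neumann series of the resolvent keeps everything algebraic: the sum telescopes,
and no convergence is required. -/
theorem neumann_sum_mem_domain {f : E} (hf : f ∈ smoothDomain D) {w : ℂ} (hw : w ≠ 0) (n : ℕ) :
    (∑ j ∈ Finset.range n, (w ^ (j + 1))⁻¹ • powApply D j f) ∈ D.domain ∧
    w • (∑ j ∈ Finset.range n, (w ^ (j + 1))⁻¹ • powApply D j f) -
      applyOrZero D (∑ j ∈ Finset.range n, (w ^ (j + 1))⁻¹ • powApply D j f) =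
      f - (w ^ n)⁻¹ • powApply D n f := by
  induction n with
  | zero => simp [powApply_zero, applyOrZero_zero]
  | succ n ih =>
    have hn := mem_smoothDomain_iff.1 hf n
    rw [Finset.sum_range_succ]
    refine ⟨D.domain.add_mem ih.1 (D.domain.smul_mem _ hn), ?_⟩
    rw [applyOrZero_add_smul ih.1 hn, smul_add, add_sub_add_comm, ih.2, ← powApply_succ, smul_smul]
    have : w * (w ^ (n + 1))⁻¹ = (w ^ n)⁻¹ := by
      rw [pow_succ]; field_simp
    rw [this]
    abel

/-- A Kolmogorov type inequality for the powers of the generator of a group of isometries. -/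
theorem norm_powApply_add_le [CompleteSpace E] (hT : IsIsometryGroup T) (hD : IsGenerator D T)
    {f : E} (hf : f ∈ smoothDomain D) {n k : ℕ} (hk : k + 2 < n) {ρ : ℝ} (hρ : 0 < ρ) :
    ‖powApply D k f + ((ρ ^ 2)⁻¹ : ℂ) • powApply D (k + 2) f‖ ≤
      2 * ρ ^ k * (‖f‖ + (ρ ^ n)⁻¹ * ‖powApply D n f‖) := by
  refine norm_laurent_coeff_le (x := fun j => powApply D j f) hk hρ fun w hw => ?_
  have hw0 : w ≠ 0 := by rintro rfl; rw [norm_zero] at hw; exact hρ.ne hw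
  obtain ⟨h1, h2⟩ := neumann_sum_mem_domain hf hw0 n
  refine (hD.abs_re_mul_norm_le hT h1 w).trans ?_
  rw [h2]
  refine (norm_sub_le _ _).trans ?_
  rw [norm_smul, norm_inv, norm_pow, hw]

/-! ### The growth rate of the powers and the infimum of admissible types. -/

/-- For each `k` choose a good `n > k + 2` in the Kolmogorov type inequality. After division by `ρ ^
k`, each step of two adds a fixed constant, hence linear growth. -/
theorem norm_powApply_le_of_frequently [CompleteSpace E] (hT : IsIsometryGroup T)
    (hD : IsGenerator D T) {f : E} (hf : f ∈ smoothDomain D) {ρ : ℝ} (hρ : 0 < ρ)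
    (hfreq : ∃ᶠ n in atTop, ‖powApply D n f‖ ≤ ρ ^ n) (k : ℕ) :
    ‖powApply D k f‖ ≤
      ρ ^ k * (‖f‖ + ‖powApply D 1 f‖ / ρ + 2 * (‖f‖ + 1) * k) := by
  have hstep : ∀ k, ‖powApply D (k + 2) f‖ ≤
      ρ ^ 2 * ‖powApply D k f‖ + ρ ^ (k + 2) * (2 * (‖f‖ + 1)) := by
    intro k
    obtain ⟨n, hn, hle⟩ := (frequently_atTop.1 hfreq) (k + 3)
    have h := norm_powApply_add_le hT hD hf (show k + 2 < n by omega) hρ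
    have h1 : (ρ ^ n)⁻¹ * ‖powApply D n f‖ ≤ 1 := by
      rw [inv_mul_le_iff₀ (by positivity), mul_one]
      exact hle
    have h2 : ‖((ρ ^ 2)⁻¹ : ℂ) • powApply D (k + 2) f‖ = (ρ ^ 2)⁻¹ * ‖powApply D (k + 2) f‖ := by
      rw [norm_smul, norm_inv, norm_pow, Complex.norm_real, Real.norm_of_nonneg hρ.le]
    have h3 : (ρ ^ 2)⁻¹ * ‖powApply D (k + 2) f‖ ≤
        2 * ρ ^ k * (‖f‖ + 1) + ‖powApply D k f‖ := by
      rw [← h2]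
      have h4 := norm_sub_le (powApply D k f + ((ρ ^ 2)⁻¹ : ℂ) • powApply D (k + 2) f)
        (powApply D k f)
      rw [add_sub_cancel_left] at h4
      refine h4.trans ?_
      gcongr
      refine h.trans ?_
      gcongr
    rw [inv_mul_le_iff₀ (by positivity)] at h3
    calc _ ≤ _ := h3
      _ = _ := by ring
  set K := ‖f‖ + ‖powApply D 1 f‖ / ρ with hK
  set A := 2 * (‖f‖ + 1) with hA
  have hA0 : 0 ≤ A := by positivity
  induction k using Nat.twoStepInduction with
  | zero =>
    rw [powApply_zero, pow_zero, one_mul, Nat.cast_zero, mul_zero, add_zero, hK]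
    have : 0 ≤ ‖powApply D 1 f‖ / ρ := by positivity
    linarith
  | one =>
    rw [pow_one, hK]
    have : ρ * (‖powApply D 1 f‖ / ρ) = ‖powApply D 1 f‖ := by field_simp
    have h1 : 0 ≤ ρ * ‖f‖ := by positivity
    have h2 : 0 ≤ ρ * (A * ((1 : ℕ) : ℝ)) := by positivity
    nlinarith
  | more k ih _ =>
    refine (hstep k).trans ?_
    calc _ ≤ ρ ^ 2 * (ρ ^ k * (K + A * k)) + ρ ^ (k + 2) * A := by gcongr
      _ = ρ ^ (k + 2) * (K + A * (k + 1)) := by ring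
      _ ≤ _ := by
        gcongr
        push_cast
        linarith

theorem mem_bernsteinSet_of_frequently [CompleteSpace E] (hT : IsIsometryGroup T)
    (hD : IsGenerator D T) {f : E} (hf : f ∈ smoothDomain D) {ρ τ : ℝ} (hρ : 0 < ρ) (hτ : ρ < τ)
    (hfreq : ∃ᶠ n in atTop, ‖powApply D n f‖ ≤ ρ ^ n) : f ∈ bernsteinSet D τ := by
  have hτ0 : 0 < τ := hρ.trans hτ
  have hlim : Tendsto (fun k : ℕ => (k : ℝ) * (ρ / τ) ^ k) atTop (𝓝 0) :=
    tendsto_self_mul_const_pow_of_lt_one (by positivity) ((div_lt_one hτ0).2 hτ)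
  obtain ⟨B, hB⟩ := hlim.bddAbove_range
  set K := ‖f‖ + ‖powApply D 1 f‖ / ρ with hK
  refine mem_bernsteinSet_of_norm_powApply_le hT hD hτ0 hf (C := K + 2 * (‖f‖ + 1) * B) fun k => ?_
  refine (norm_powApply_le_of_frequently hT hD hf hρ hfreq k).trans ?_
  have h1 : (k : ℝ) * (ρ / τ) ^ k ≤ B := hB ⟨k, rfl⟩
  have h2 : (k : ℝ) * ρ ^ k ≤ B * τ ^ k := by
    rw [div_pow, mul_div_assoc', div_le_iff₀ (by positivity)] at h1
    exact h1
  have h3 : ρ ^ k ≤ τ ^ k := by gcongr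
  have hK0 : 0 ≤ K := by positivity
  calc ρ ^ k * (K + 2 * (‖f‖ + 1) * k) = K * ρ ^ k + 2 * (‖f‖ + 1) * (k * ρ ^ k) := by ring
    _ ≤ K * τ ^ k + 2 * (‖f‖ + 1) * (B * τ ^ k) := by gcongr
    _ = _ := by ring

theorem rpow_one_div_le_iff {a b : ℝ} (ha : 0 ≤ a) (hb : 0 ≤ b) {k : ℕ} (hk : k ≠ 0) :
    a ^ (1 / (k : ℝ)) ≤ b ↔ a ≤ b ^ k := by
  rw [one_div, Real.rpow_inv_le_iff_of_pos ha hb (by positivity), Real.rpow_natCast]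

theorem mem_bernsteinSet_of_eventually [CompleteSpace E] (hT : IsIsometryGroup T)
    (hD : IsGenerator D T) {f : E} {d τ : ℝ} (hf : HasPowLimit D f d) (hd : d < τ) (hτ : 0 < τ) :
    f ∈ bernsteinSet D τ := by
  have h1 := hf.2.eventually (gt_mem_nhds hd)
  obtain ⟨N, hN⟩ := eventually_atTop.1 (h1.and (eventually_ne_atTop 0))
  have hNle : ∀ k, N ≤ k → ‖powApply D k f‖ ≤ τ ^ k := fun k hk =>
    (rpow_one_div_le_iff (norm_nonneg _) hτ.le (hN k hk).2).1 (hN k hk).1.le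
  refine mem_bernsteinSet_of_norm_powApply_le hT hD hτ hf.1
    (C := 1 + ∑ j ∈ Finset.range N, ‖powApply D j f‖ / τ ^ j) fun k => ?_
  have h0 : ∀ j, 0 ≤ ‖powApply D j f‖ / τ ^ j := fun j => by positivity
  rw [← div_le_iff₀ (by positivity)]
  rcases lt_or_ge k N with hk | hk
  · have := Finset.single_le_sum (fun j _ => h0 j) (Finset.mem_range.2 hk)
    linarith
  · have h2 : ‖powApply D k f‖ / τ ^ k ≤ 1 := (div_le_one (by positivity)).2 (hNle k hk)
    have := Finset.sum_nonneg fun j (_ : j ∈ Finset.range N) => h0 j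
    linarith

theorem eventually_rpow_lt {f : E} {τ b : ℝ} (hf : τ ∈ admissible D f) (hb : τ < b) :
    ∀ᶠ k : ℕ in atTop, ‖powApply D k f‖ ^ (1 / (k : ℝ)) < b := by
  -- The maximum with `1` keeps `C` positive when `f = 0`, so that `C ^ (1 / k)` tends to `1`.
  set C := max ‖f‖ 1 with hC
  have hC0 : 0 < C := lt_max_of_lt_right one_pos
  have hlim : Tendsto (fun k : ℕ => τ * C ^ (1 / (k : ℝ))) atTop (𝓝 (τ * C ^ (0 : ℝ))) := by
    refine Tendsto.const_mul _ ?_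
    exact (Real.continuousAt_const_rpow hC0.ne').tendsto.comp tendsto_one_div_atTop_nhds_zero_nat
  rw [Real.rpow_zero, mul_one] at hlim
  filter_upwards [hlim.eventually (gt_mem_nhds hb), eventually_ne_atTop 0] with k hk hk0
  refine lt_of_le_of_lt ?_ hk
  have hτ := hf.1
  rw [rpow_one_div_le_iff (norm_nonneg _) (by positivity) hk0, mul_pow, ← Real.rpow_natCast (C ^ _),
    ← Real.rpow_mul hC0.le, one_div, inv_mul_cancel₀ (by exact_mod_cast hk0), Real.rpow_one]
  exact (hf.2.2 k).trans (by gcongr; exact le_max_left _ _)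

theorem HasPowLimit.isGLB [CompleteSpace E] (hT : IsIsometryGroup T) (hD : IsGenerator D T)
    {f : E} {d : ℝ} (hf : HasPowLimit D f d) : IsGLB (admissible D f) d := by
  refine ⟨fun τ hτ => ?_, fun x hx => ?_⟩
  · refine le_of_forall_gt_imp_ge_of_dense fun b hb => ?_
    exact le_of_tendsto hf.2 ((eventually_rpow_lt hτ hb).mono fun _ h => h.le)
  · have hd0 : 0 ≤ d := ge_of_tendsto hf.2
      (Eventually.of_forall fun k => Real.rpow_nonneg (norm_nonneg _) _)
    refine le_of_forall_gt_imp_ge_of_dense fun τ hτ => ?_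
    have hτ0 : 0 < τ := hd0.trans_lt hτ
    exact hx ⟨hτ0, mem_bernsteinSet_of_eventually hT hD hf hτ hτ0⟩

theorem exists_hasPowLimit [CompleteSpace E] (hT : IsIsometryGroup T) (hD : IsGenerator D T)
    {f : E} (hne : (admissible D f).Nonempty) : ∃ d, HasPowLimit D f d := by
  obtain ⟨σ, hσ⟩ := hne
  have hsm : f ∈ smoothDomain D := hσ.2.1
  have hbdd : BddBelow (admissible D f) := ⟨0, fun τ hτ => hτ.1.le⟩
  refine ⟨sInf (admissible D f), hsm, tendsto_order.2 ⟨fun b hb => ?_, fun b hb => ?_⟩⟩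
  · rcases lt_or_ge b 0 with hb0 | hb0
    · exact Eventually.of_forall fun k => hb0.trans_le (Real.rpow_nonneg (norm_nonneg _) _)
    · obtain ⟨ρ, hbρ, hρ⟩ := exists_between hb
      obtain ⟨τ, hρτ, hτ⟩ := exists_between hρ
      have hρ0 : 0 < ρ := hb0.trans_lt hbρ
      -- Otherwise `‖D ^ k f‖ ≤ ρ ^ k` infinitely often, making `τ` admissible although it lies
      -- below the infimum.
      have hev : ∀ᶠ k : ℕ in atTop, ρ ^ k < ‖powApply D k f‖ := by
        by_contra hcon
        refine notMem_of_lt_csInf hτ hbdd ⟨hρ0.trans hρτ, ?_⟩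
        refine mem_bernsteinSet_of_frequently hT hD hsm hρ0 hρτ ?_
        simpa only [not_eventually, not_lt] using hcon
      filter_upwards [hev, eventually_ne_atTop 0] with k hk hk0
      refine hbρ.trans (lt_of_not_ge fun hle => hk.not_ge ?_)
      exact (rpow_one_div_le_iff (norm_nonneg _) hρ0.le hk0).1 hle
  · obtain ⟨τ, hτ, hlt⟩ := exists_lt_of_csInf_lt ⟨σ, hσ⟩ hb
    exact eventually_rpow_lt hτ hlt

/-- The inequalities hold for every `τ > σ`, and each survives the limit `τ → σ`; this covers the
borderline `d = σ`. -/
theorem mem_bernsteinSet_of_isGLB {f : E} {d σ : ℝ} (hf : f ∈ smoothDomain D)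
    (hd : IsGLB (admissible D f) d) (hσ : d ≤ σ) : f ∈ bernsteinSet D σ := by
  refine ⟨hf, fun k => ?_⟩
  have hlim : Tendsto (fun τ : ℝ => τ ^ k * ‖f‖) (𝓝[>] σ) (𝓝 (σ ^ k * ‖f‖)) :=
    tendsto_nhdsWithin_of_tendsto_nhds (Continuous.tendsto (by fun_prop) σ)
  refine ge_of_tendsto hlim (eventually_nhdsWithin_of_forall fun τ hτ => ?_)
  obtain ⟨τ', hτ', -, hlt⟩ := hd.exists_between (hσ.trans_lt hτ)
  have h0 := hτ'.1
  exact (hτ'.2.2 k).trans (by gcongr)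

end Group

end BernsteinVectors

end

theorem mainTheorem1 {E : Type*} [NormedAddCommGroup E] [NormedSpace ℂ E] [CompleteSpace E]
    (D : E →ₗ.[ℂ] E) (T : ℝ → E →L[ℂ] E)
    (hT : BernsteinVectors.IsIsometryGroup T) (hD : BernsteinVectors.IsGenerator D T) (f : E) :
    (∀ σ : ℝ, 0 < σ → List.TFAE
      [ f ∈ BernsteinVectors.bernsteinSet D σ,
        BernsteinVectors.MemBernstein σ (fun t : ℝ => T t f),
        ∀ g : E →L[ℂ] ℂ, BernsteinVectors.MemBernstein σ (fun t : ℝ => g (T t f)),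
        BernsteinVectors.BoasFormulas D T σ f,
        ∃ d : ℝ, BernsteinVectors.HasPowLimit D f d ∧
          IsGLB (BernsteinVectors.admissible D f) d ∧ d ≤ σ ]) ∧
    List.TFAE
      [ ∃ σ : ℝ, 0 < σ ∧ f ∈ BernsteinVectors.bernsteinSet D σ,
        ∃ d : ℝ, BernsteinVectors.HasPowLimit D f d ∧
          IsGLB (BernsteinVectors.admissible D f) d,
        ∃ d : ℝ, BernsteinVectors.HasPowLimit D f d ] := by
  refine ⟨fun σ hσ => ?_, ?_⟩
  · tfae_have 1 → 2 := fun h =>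
      BernsteinVectors.memBernstein_of_norm_powApply_le hT hD h.1 (C := ‖f‖)
        fun k => by rw [mul_comm]; exact h.2 k
    tfae_have 2 → 3 := fun h g => h.clm_comp g
    tfae_have 3 → 1 := BernsteinVectors.mem_bernsteinSet_of_forall_dual hT hD hσ
    tfae_have 1 → 4 := BernsteinVectors.boasFormulas_of_mem_bernsteinSet hT hD hσ
    tfae_have 4 → 1 := BernsteinVectors.mem_bernsteinSet_of_boasFormulas hT hD hσ
    tfae_have 1 → 5 := by
      intro h
      obtain ⟨d, hd⟩ := BernsteinVectors.exists_hasPowLimit hT hD ⟨σ, hσ, h⟩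
      exact ⟨d, hd, hd.isGLB hT hD, (hd.isGLB hT hD).1 ⟨hσ, h⟩⟩
    tfae_have 5 → 1 := fun ⟨d, hd, hglb, hle⟩ =>
      BernsteinVectors.mem_bernsteinSet_of_isGLB hd.1 hglb hle
    tfae_finish
  · tfae_have 1 → 3 := fun ⟨σ, hσ, h⟩ => BernsteinVectors.exists_hasPowLimit hT hD ⟨σ, hσ, h⟩
    tfae_have 3 → 2 := fun ⟨d, hd⟩ => ⟨d, hd, hd.isGLB hT hD⟩
    tfae_have 2 → 1 := fun ⟨d, _, hglb⟩ => hglb.nonempty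
    tfae_finish
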